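/- All graphs are simple and undirected. A graph is chordal if every cycle of length at least $4$ has a chord. A graph $G$ is nearly chordal if for every vertex $v$ the graph $G-N[v]$ is chordal, where $N[v]$ is the closed neighbourhood of $v$. A vertex misses a path if it has no neighbour on the path. Vertices $x,y$ avoid vertices $z,w$ if there is an $xy$-path missed by both $z$ and $w$, or a $zw$-path missed by both $x$ and $y$. Four distinct vertices $x,y,z,w$ form a blocking quadruple of $G$ if $x,y$ avoid $z,w$, and $x,z$ avoid $y,w$, and $x,w$ avoid $y,z$. Consider the following graphs; a pendant vertex at $u$ is a vertex of degree one whose only neighbour is $u$. - a) A triangle with one pendant vertex at each of its three vertices, together with an isolated vertex. - b) A path on five vertices, a vertex adjacent to all five vertices of the path, and a pendant vertex at the middle vertex of the path, together with an isolated vertex. - c) For each $k\ge 1$: a path $p_1\cdots p_k$ (all of whose edges are $p_ip_{i+1}$), two adjacent vertices $\ell,r$ both adjacent to all of $p_1,\dots,p_k$, a vertex with neighbours exactly $\ell$ and $r$, a vertex with neighbours exactly $\ell$ and $p_1$, a vertex with neighbours exactly $r$ and $p_k$, together with an isolated vertex. - d) For each $m\ge 2$: a path $p_0\cdots p_m$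 with $m$ edges, a vertex $h$ adjacent to all of $p_0,\dots,p_m$, and a pendant vertex at each of $h$, $p_0$ and $p_m$. - e) The tree obtained from a star with three leaves by attaching a pendant vertex to each leaf. - f) A triangle with pendant vertices at two of its vertices and, at the third, a pendant path with two edges. - g) A complete graph on four vertices with pendant vertices at exactly three of them, one at each. Theorem. If $G$ is nearly chordal, then $G$ has a blocking quadruple if and only if $G$ contains an induced subgraph isomorphic to one of the graphs a)–g). In particular, the same equivalence holds for every chordal graph $G$. -/

import Mathlib

namespace BlockingQuadruple

/-- A graph is chordal if every cycle of length at least four has a chord: an edge of the graph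
that joins two vertices of the cycle and is not an edge of the cycle. -/
def IsChordal {V : Type*} (G : SimpleGraph V) : Prop :=
  ∀ (v : V) (c : G.Walk v v), c.IsCycle → 4 ≤ c.length →
    ∃ x ∈ c.support, ∃ y ∈ c.support, G.Adj x y ∧ s(x, y) ∉ c.edges

/-- The closed neighbourhood `N[v]`. -/
def closedNeighborSet {V : Type*} (G : SimpleGraph V) (v : V) : Set V :=
  insert v (G.neighborSet v)

/-- A graph `G` is nearly chordal if `G - N[v]` is chordal for every vertex `v`. -/
def IsNearlyChordal {V : Type*} (G : SimpleGraph V) : Prop :=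
  ∀ v : V, IsChordal (G.induce (closedNeighborSet G v)ᶜ)

/-- The vertex `z` misses `p` if it has no neighbour on `p`. -/
def Misses {V : Type*} (G : SimpleGraph V) (z : V) {x y : V} (p : G.Walk x y) : Prop :=
  ∀ u ∈ p.support, ¬ G.Adj z u

/-- `x, y` avoid `z, w`: some `xy`-path is missed by both `z` and `w`, or some `zw`-path is
missed by both `x` and `y`. -/
def Avoid {V : Type*} (G : SimpleGraph V) (x y z w : V) : Prop :=
  (∃ p : G.Walk x y, p.IsPath ∧ Misses G z p ∧ Misses G w p) ∨
  (∃ p : G.Walk z w, p.IsPath ∧ Misses G x p ∧ Misses G y p)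

/-- Four distinct vertices form a blocking quadruple if any two of them avoid the other two. -/
def IsBlockingQuadruple {V : Type*} (G : SimpleGraph V) (x y z w : V) : Prop :=
  (x ≠ y ∧ x ≠ z ∧ x ≠ w ∧ y ≠ z ∧ y ≠ w ∧ z ≠ w) ∧
  Avoid G x y z w ∧ Avoid G x z y w ∧ Avoid G x w y z

/-- The graph contains a blocking quadruple. -/
def HasBlockingQuadruple {V : Type*} (G : SimpleGraph V) : Prop :=
  ∃ x y z w : V, IsBlockingQuadruple G x y z w

/-- Graph a): a triangle `0 1 2` with a pendant vertex at each of its vertices,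
together with the isolated vertex `6`. -/
def graphA : SimpleGraph (Fin 7) :=
  SimpleGraph.fromEdgeSet {s(0, 1), s(0, 2), s(1, 2), s(0, 3), s(1, 4), s(2, 5)}

/-- Graph b): a path `0 1 2 3 4`, a vertex `5` adjacent to all of this path, a pendant vertex `6`
at the middle `2` of the path, and the isolated vertex `7`. -/
def graphB : SimpleGraph (Fin 8) :=
  SimpleGraph.fromEdgeSet
    {s(0, 1), s(1, 2), s(2, 3), s(3, 4),
      s(5, 0), s(5, 1), s(5, 2), s(5, 3), s(5, 4), s(2, 6)}

/-- Vertices of a graph of family c), whose horizontal path `p` has `k` vertices between the two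
corners `b` and `c`. -/
inductive VertexC (k : ℕ) : Type
  | a : VertexC k
  | b : VertexC k
  | c : VertexC k
  | d : VertexC k
  | l : VertexC k
  | r : VertexC k
  | p : Fin k → VertexC k

/-- One orientation of every edge of a graph of family c). -/
def edgeC (k : ℕ) : VertexC k → VertexC k → Prop
  | .a, .l => True
  | .a, .r => True
  | .l, .r => True
  | .b, .l => True
  | .c, .r => True
  | .b, .p i => i.val = 0
  | .c, .p i => i.val + 1 = k
  | .l, .p _ => True
  | .r, .p _ => True
  | .p i, .p j => i.val + 1 = j.val
  | _, _ => False

/-- Family c), used for `k ≥ 1`: a path `p 0, …, p (k - 1)`, adjacent vertices `l`, `r` that are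
both adjacent to all of the path, a vertex `a` adjacent to `l` and `r`, a vertex `b` adjacent to
`l` and the first path vertex, a vertex `c` adjacent to `r` and the last path vertex, and an
isolated vertex `d`. -/
def graphC (k : ℕ) : SimpleGraph (VertexC k) :=
  SimpleGraph.fromRel (edgeC k)

/-- Vertices of a graph of family d), whose horizontal path `p` has `m` edges. -/
inductive VertexD (m : ℕ) : Type
  | a : VertexD m
  | b : VertexD m
  | c : VertexD m
  | h : VertexD m
  | p : Fin (m + 1) → VertexD m

/-- One orientation of every edge of a graph of family d). -/
def edgeD (m : ℕ) : VertexD m → VertexD m → Prop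
  | .a, .h => True
  | .b, .p i => i.val = 0
  | .c, .p i => i.val = m
  | .h, .p _ => True
  | .p i, .p j => i.val + 1 = j.val
  | _, _ => False

/-- Family d), used for `m ≥ 2`: a path `p 0, …, p m` with `m` edges, a vertex `h` adjacent to all
of the path, and pendant vertices `a`, `b`, `c` at `h`, at `p 0` and at `p m`. -/
def graphD (m : ℕ) : SimpleGraph (VertexD m) :=
  SimpleGraph.fromRel (edgeD m)

/-- Graph e): the tree obtained from the star with centre `0` and three leaves `1, 2, 3` by
attaching a pendant vertex to each leaf. -/
def graphE : SimpleGraph (Fin 7) :=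
  SimpleGraph.fromEdgeSet {s(0, 1), s(0, 2), s(0, 3), s(1, 4), s(2, 5), s(3, 6)}

/-- Graph f): a triangle `0 1 2` with a pendant vertex at `0`, a pendant vertex at `1`, and a
pendant path `2 5 6` with two edges at `2`. -/
def graphF : SimpleGraph (Fin 7) :=
  SimpleGraph.fromEdgeSet {s(0, 1), s(0, 2), s(1, 2), s(0, 3), s(1, 4), s(2, 5), s(5, 6)}

/-- Graph g): a complete graph on `0, 1, 2, 3` with a pendant vertex at each of `0, 1, 2`. -/
def graphG : SimpleGraph (Fin 7) :=
  SimpleGraph.fromEdgeSet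
    {s(0, 1), s(0, 2), s(1, 2), s(0, 3), s(1, 3), s(2, 3), s(0, 4), s(1, 5), s(2, 6)}

/-- `G` contains an induced subgraph isomorphic to one of the graphs a)-g). -/
def ContainsForbidden {V : Type*} (G : SimpleGraph V) : Prop :=
  graphA.IsIndContained G ∨
  graphB.IsIndContained G ∨
  (∃ k : ℕ, 1 ≤ k ∧ (graphC k).IsIndContained G) ∨
  (∃ m : ℕ, 2 ≤ m ∧ (graphD m).IsIndContained G) ∨
  graphE.IsIndContained G ∨
  graphF.IsIndContained G ∨
  graphG.IsIndContained G

end BlockingQuadruple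

namespace BlockingQuadruple

/-! Each of the three avoidances offers two possible walks, so a blocking quadruple selects one edge
from each perfect matching of a complete graph on its four vertices. Three such edges form a star or
a triangle. For a star, one vertex is joined to each of the others by a walk far from the remaining
two (`IsStar`). For a triangle, three of the vertices form an asteroidal triple in the graph minus
the closed neighbourhood of the fourth (`IsAsteroidalTriple`).

Both cases go by induction on the total length of the three walks, which may be taken to be induced
paths. Chordality enters only through `exists_common_neighbor`: an edge on a cycle lies in a
triangle with another vertex of that cycle. It is applicable because the vertices concerned are
always far from one vertex of the quadruple.

For a star with centre `w`, consider the first vertices `f 1`, `g 1`, `h 1` of the paths. If two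
coincide, the centre moves there and the total length drops. Otherwise the number of adjacencies
among them decides: none gives e), one gives f) or d), two give d), three give g), unless moving the
centre shortens the walks.

For an asteroidal triple, two paths of length two give c). Otherwise let a neighbour of one vertex
of the triple see the opposite path: having no neighbour there, it yields a smaller triple; several
neighbours give a) or d), and a single one away from the ends gives e)
(`containsForbidden_or_unique_neighbor`). What remains is a single neighbour next to an end; this
yields b) if exactly one path has length two, and a chordless cycle if none has.

Conversely, blocking quadruples pass from induced subgraphs to the whole graph, so it suffices to
exhibit one in each listed graph. -/

variable {V : Type*} {G : SimpleGraph V}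

/-! ### Walks inside a set of vertices, and induced paths -/

/-- Two vertices are far from each other if they are distinct and nonadjacent. -/
def Far (G : SimpleGraph V) (a b : V) : Prop := a ≠ b ∧ ¬ G.Adj a b

theorem Far.symm {a b : V} (h : Far G a b) : Far G b a :=
  ⟨h.1.symm, fun h' => h.2 h'.symm⟩

/-- `u` and `v` are joined by a walk of length `n` all of whose vertices satisfy `P`. -/
def Joined (G : SimpleGraph V) (P : V → Prop) (n : ℕ) (u v : V) : Prop :=
  ∃ p : G.Walk u v, p.length = n ∧ ∀ t ∈ p.support, P t

namespace Joined

variable {P : V → Prop} {n m : ℕ} {u v w : V}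

theorem refl (h : P u) : Joined G P 0 u u := ⟨.nil, rfl, by simpa using h⟩

theorem cons (huv : G.Adj u v) (hu : P u) (h : Joined G P n v w) : Joined G P (n + 1) u w := by
  obtain ⟨p, hp, h⟩ := h
  refine ⟨.cons huv p, by simp [hp], ?_⟩
  simpa using ⟨hu, h⟩

theorem symm (h : Joined G P n u v) : Joined G P n v u := by
  obtain ⟨p, hp, h⟩ := h
  exact ⟨p.reverse, by simp [hp], by simpa using h⟩

theorem trans (h : Joined G P n u v) (h' : Joined G P m v w) : Joined G P (n + m) u w := by
  obtain ⟨p, hp, h⟩ := h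
  obtain ⟨q, hq, h'⟩ := h'
  refine ⟨p.append q, by simp [hp, hq], ?_⟩
  intro t ht
  rcases (SimpleGraph.Walk.mem_support_append_iff _ _).1 ht with ht | ht
  exacts [h t ht, h' t ht]

theorem mono {Q : V → Prop} (hPQ : ∀ t, P t → Q t) (h : Joined G P n u v) :
    Joined G Q n u v := by
  obtain ⟨p, hp, h⟩ := h
  exact ⟨p, hp, fun t ht => hPQ t (h t ht)⟩

theorem left (h : Joined G P n u v) : P u := by
  obtain ⟨p, hp, h⟩ := h
  exact h u p.start_mem_support

theorem right (h : Joined G P n u v) : P v := h.symm.left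

theorem of_chain (f : ℕ → V) (i j : ℕ) (hij : i ≤ j)
    (hadj : ∀ t, i ≤ t → t < j → G.Adj (f t) (f (t + 1)))
    (hP : ∀ t, i ≤ t → t ≤ j → P (f t)) : Joined G P (j - i) (f i) (f j) := by
  induction j, hij using Nat.le_induction with
  | base => simpa using refl (hP i le_rfl le_rfl)
  | succ j hij ih =>
    have h1 := ih (fun t h h' => hadj t h (by omega)) (fun t h h' => hP t h (by omega))
    have h2 : Joined G P 1 (f j) (f (j + 1)) :=
      cons (hadj j hij (by omega)) (hP j hij (by omega)) (refl (hP _ (by omega) le_rfl))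
    have := h1.trans h2
    rwa [show j + 1 - i = j - i + 1 by omega]

theorem exists_chain (h : Joined G P n u v) : ∃ f : ℕ → V, f 0 = u ∧ f n = v ∧
    (∀ t, t < n → G.Adj (f t) (f (t + 1))) ∧ ∀ t, P (f t) := by
  obtain ⟨p, rfl, h⟩ := h
  exact ⟨p.getVert, by simp, by simp, fun t ht => p.adj_getVert_succ ht,
    fun t => h _ (p.getVert_mem_support t)⟩

end Joined

/-- `f 0, …, f n` is an induced path from `u` to `v` all of whose vertices satisfy `P`. -/
structure IsInducedPath (G : SimpleGraph V) (P : V → Prop) (f : ℕ → V) (n : ℕ) (u v : V) :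
    Prop where
  start : f 0 = u
  finish : f n = v
  mem : ∀ i, i ≤ n → P (f i)
  inj : ∀ i j, i ≤ n → j ≤ n → f i = f j → i = j
  adj : ∀ i j, i ≤ n → j ≤ n → (G.Adj (f i) (f j) ↔ i + 1 = j ∨ j + 1 = i)

namespace IsInducedPath

variable {P : V → Prop} {f : ℕ → V} {n : ℕ} {u v : V}

theorem rev (h : IsInducedPath G P f n u v) :
    IsInducedPath G P (fun i => f (n - i)) n v u where
  start := by simpa using h.finish
  finish := by simpa using h.start
  mem i _ := h.mem _ (by omega)
  inj i j hi hj hij := by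
    have := h.inj _ _ (by omega) (by omega) hij
    omega
  adj i j hi hj := by
    rw [h.adj _ _ (by omega) (by omega)]
    omega

theorem joined (h : IsInducedPath G P f n u v) {Q : V → Prop} (i j : ℕ) (hij : i ≤ j)
    (hj : j ≤ n) (hQ : ∀ t, i ≤ t → t ≤ j → Q (f t)) : Joined G Q (j - i) (f i) (f j) :=
  .of_chain f i j hij
    (fun t _ ht => (h.adj t (t + 1) (by omega) (by omega)).2 (Or.inl rfl)) hQ

theorem far (h : IsInducedPath G P f n u v) {i j : ℕ} (hi : i ≤ n) (hj : j ≤ n)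
    (hij : i + 1 < j ∨ j + 1 < i) : Far G (f i) (f j) := by
  refine ⟨fun he => ?_, fun ha => ?_⟩
  · have := h.inj i j hi hj he
    omega
  · have := (h.adj i j hi hj).1 ha
    omega

theorem adj_succ (h : IsInducedPath G P f n u v) {i : ℕ} (hi : i < n) :
    G.Adj (f i) (f (i + 1)) := (h.adj i (i + 1) (by omega) (by omega)).2 (Or.inl rfl)

theorem mono {Q : V → Prop} (h : IsInducedPath G P f n u v) (hPQ : ∀ t, P t → Q t) :
    IsInducedPath G Q f n u v := ⟨h.start, h.finish, fun i hi => hPQ _ (h.mem i hi), h.inj, h.adj⟩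

end IsInducedPath

/-- A repeated vertex or a chord of the walk would give a shortcut through vertices that still
satisfy `P`. -/
theorem Joined.isInducedPath_of_shortest {P : V → Prop} {n : ℕ} {u v : V}
    (h : Joined G P n u v) (hmin : ∀ m < n, ¬ Joined G P m u v) :
    ∃ f, IsInducedPath G P f n u v := by
  obtain ⟨f, h0, hn, hadj, hP⟩ := h.exists_chain
  have seg : ∀ i j, i ≤ j → j ≤ n → Joined G P (j - i) (f i) (f j) := fun i j hij hj =>
    .of_chain f i j hij (fun t _ ht => hadj t (by omega)) (fun t _ _ => hP t)
  have hne : ∀ i j, i < j → j ≤ n → f i ≠ f j := by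
    intro i j hij hj he
    have h1 := seg 0 i (by omega) (by omega)
    have h2 := seg j n (by omega) (by omega)
    rw [he] at h1
    have := h1.trans h2
    rw [h0, hn] at this
    exact hmin _ (by omega) this
  have hnadj : ∀ i j, i + 1 < j → j ≤ n → ¬ G.Adj (f i) (f j) := by
    intro i j hij hj ha
    have h1 := seg 0 i (by omega) (by omega)
    have h2 := seg j n (by omega) (by omega)
    have := h1.trans (.cons ha (hP i) h2)
    rw [h0, hn] at this
    exact hmin _ (by omega) this
  refine ⟨f, h0, hn, fun i _ => hP i, ?_, ?_⟩
  · intro i j hi hj he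
    rcases lt_trichotomy i j with hlt | heq | hlt
    exacts [absurd he (hne i j hlt hj), heq, absurd he.symm (hne j i hlt hi)]
  · intro i j hi hj
    constructor
    · intro ha
      by_contra hc
      have hij : i ≠ j := by rintro rfl; exact G.loopless.irrefl _ ha
      rcases Nat.lt_or_gt_of_ne hij with hlt | hlt
      · exact hnadj i j (by omega) hj ha
      · exact hnadj j i (by omega) hi ha.symm
    · rintro (rfl | rfl)
      · exact hadj i (by omega)
      · exact (hadj j (by omega)).symm

/-- Either a walk can be shortened, or its vertices form an induced path. -/
theorem Joined.shorter_or_isInducedPath {P : V → Prop} {n : ℕ} {u v : V}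
    (h : Joined G P n u v) :
    (∃ m < n, Joined G P m u v) ∨ ∃ f, IsInducedPath G P f n u v := by
  by_cases hmin : ∃ m < n, Joined G P m u v
  · exact Or.inl hmin
  · push Not at hmin
    exact Or.inr (h.isInducedPath_of_shortest hmin)

/-! ### Triangles on cycles of chordal graphs -/

theorem mk_getVert_mem_edges {u v : V} (p : G.Walk u v) {i : ℕ} (hi : i < p.length) :
    s(p.getVert i, p.getVert (i + 1)) ∈ p.edges := by
  induction p generalizing i with
  | nil => simp at hi
  | cons h p ih =>
    cases i with
    | zero => simp
    | succ i =>
      have := ih (i := i) (by simpa using hi)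
      simp [this]

/-- In a chordal graph, an edge that lies on a cycle lies in a triangle whose third vertex is on
that cycle. -/
theorem IsChordal.exists_common_neighbor (hG : IsChordal G) {S : V → Prop} {u v a b : V} {n : ℕ}
    (huv : G.Adj u v) (hu : ¬ S u) (hv : ¬ S v) (hab : Joined G S n a b)
    (hua : G.Adj u a) (hvb : G.Adj v b) : ∃ s, S s ∧ G.Adj u s ∧ G.Adj v s := by
  classical
  by_contra hcon
  push Not at hcon
  -- The walk in `S` is minimal over all choices of its ends in the two neighbourhoods. Without a
  -- common neighbour it has `n ≥ 1` edges, so closing it through `u` and `v` gives a cycle of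
  -- length `n + 3 ≥ 4`, and minimality excludes every chord.
  have hex : ∃ n, ∃ a b, G.Adj u a ∧ G.Adj v b ∧ Joined G S n a b := ⟨n, a, b, hua, hvb, hab⟩
  obtain ⟨a, b, hua, hvb, hab⟩ := Nat.find_spec hex
  have hmin := fun m hm => Nat.find_min hex (m := m) hm
  generalize Nat.find hex = n at hab hmin
  have hu' : ∀ c m, m < n → G.Adj u c → ¬ Joined G S m c b := fun c m hm hc h =>
    hmin m hm ⟨c, b, hc, hvb, h⟩
  have hv' : ∀ c m, m < n → G.Adj v c → ¬ Joined G S m a c := fun c m hm hc h =>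
    hmin m hm ⟨a, c, hua, hc, h⟩
  obtain ⟨p, hpn, hpS⟩ := hab
  have seg : ∀ i j, i ≤ j → j ≤ n → Joined G S (j - i) (p.getVert i) (p.getVert j) :=
    fun i j hij hj => .of_chain p.getVert i j hij
      (fun t _ ht => p.adj_getVert_succ (by omega)) (fun t _ _ => hpS _ (p.getVert_mem_support t))
  have h0 : p.getVert 0 = a := by simp
  have hn : p.getVert n = b := by simp [← hpn]
  have ht : ∀ m < n, ¬ Joined G S m a b := fun m hm => hu' a m hm hua
  have hn0 : n ≠ 0 := by
    rintro rfl
    have hab : a = b := h0.symm.trans hn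
    exact hcon a (hpS a p.start_mem_support) hua (hab ▸ hvb)
  have hne : ∀ i j, i < j → j ≤ n → p.getVert i ≠ p.getVert j := by
    intro i j hij hj he
    have h1 := seg 0 i (by omega) (by omega)
    have h2 := seg j n (by omega) (by omega)
    rw [he] at h1
    have := h1.trans h2
    rw [h0, hn] at this
    exact ht _ (by omega) this
  have hnadj : ∀ i j, i + 1 < j → j ≤ n → ¬ G.Adj (p.getVert i) (p.getVert j) := by
    intro i j hij hj ha
    have h1 := seg 0 i (by omega) (by omega)
    have h2 := seg j n (by omega) (by omega)
    have := h1.trans (.cons ha (hpS _ (p.getVert_mem_support i)) h2)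
    rw [h0, hn] at this
    exact ht _ (by omega) this
  have hun : ∀ i, i ≤ n → G.Adj u (p.getVert i) → i = 0 := by
    intro i hi h
    by_contra hi0
    have := seg i n hi le_rfl
    rw [hn] at this
    exact hu' _ _ (by omega) h this
  have hvn : ∀ i, i ≤ n → G.Adj v (p.getVert i) → i = n := by
    intro i hi h
    by_contra hi0
    have := seg 0 i (by omega) hi
    rw [h0] at this
    exact hv' _ _ (by omega) h this
  have hpath : p.IsPath := by
    rw [← SimpleGraph.Walk.IsPath.getVert_injOn_iff]
    intro i hi j hj he
    simp only [Set.mem_ofPred_eq, hpn] at hi hj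
    rcases lt_trichotomy i j with hlt | heq | hlt
    exacts [absurd he (hne i j hlt hj), heq, absurd he.symm (hne j i hlt hi)]
  have hup : u ∉ p.support := fun h => hu (hpS u h)
  have hvp : v ∉ p.support := fun h => hv (hpS v h)
  let c : G.Walk v v := .cons huv.symm (.cons hua (p.concat hvb.symm))
  have hc : c.IsCycle := by
    rw [SimpleGraph.Walk.cons_isCycle_iff]
    refine ⟨?_, ?_⟩
    · rw [SimpleGraph.Walk.cons_isPath_iff, SimpleGraph.Walk.concat_isPath_iff]
      refine ⟨⟨hpath, hvp⟩, ?_⟩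
      simp [SimpleGraph.Walk.support_concat, hup, huv.ne]
    · have hau : a ≠ v := by rintro rfl; exact hvp p.start_mem_support
      have hav : a ≠ u := by rintro rfl; exact hup p.start_mem_support
      have hbu : b ≠ u := by rintro rfl; exact hup p.end_mem_support
      have h1 : s(v, u) ∉ p.edges := fun h => hvp (p.fst_mem_support_of_mem_edges h)
      simp [SimpleGraph.Walk.edges_concat, h1, huv.ne, huv.ne', hau.symm, hbu.symm]
  obtain ⟨x, hx, y, hy, hxy, he⟩ := hG v c hc (by
    simp only [c, SimpleGraph.Walk.length_cons, SimpleGraph.Walk.length_concat]; omega)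
  have hE : ∀ e, e ∉ c.edges → e ≠ s(v, u) ∧ e ≠ s(u, a) ∧ e ∉ p.edges ∧ e ≠ s(b, v) := by
    intro e he
    simp only [c, SimpleGraph.Walk.edges_cons, SimpleGraph.Walk.edges_concat, List.mem_cons,
      List.mem_append, List.concat_eq_append, not_or] at he
    tauto
  have hS : ∀ x, x ∈ c.support → x = u ∨ x = v ∨ ∃ i, i ≤ n ∧ p.getVert i = x := by
    intro x hx
    simp only [c, SimpleGraph.Walk.support_cons, SimpleGraph.Walk.support_concat, List.mem_cons,
      List.mem_append] at hx
    rw [SimpleGraph.Walk.mem_support_iff_exists_getVert] at hx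
    rw [hpn] at hx
    simp only [List.not_mem_nil, or_false] at hx
    rcases hx with h | h | ⟨i, h, h'⟩ | h
    exacts [Or.inr (Or.inl h), Or.inl h, Or.inr (Or.inr ⟨i, h', h⟩), Or.inr (Or.inl h)]
  obtain ⟨e1, e2, e3, e4⟩ := hE _ he
  have key : ∀ i j, i < j → j ≤ n → G.Adj (p.getVert i) (p.getVert j) →
      s(p.getVert i, p.getVert j) ∈ p.edges := by
    intro i j hij hj ha
    have : j = i + 1 := by
      by_contra hne
      exact hnadj i j (by omega) hj ha
    subst this
    exact mk_getVert_mem_edges p (by omega)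
  rcases hS x hx with rfl | rfl | ⟨i, hi, rfl⟩ <;> rcases hS y hy with rfl | rfl | ⟨j, hj, rfl⟩
  · exact G.loopless.irrefl _ hxy
  · exact e1 Sym2.eq_swap
  · obtain rfl := hun j hj hxy
    rw [h0] at e2
    exact e2 rfl
  · exact e1 rfl
  · exact G.loopless.irrefl _ hxy
  · obtain rfl := hvn j hj hxy
    rw [hn] at e4
    exact e4 Sym2.eq_swap
  · obtain rfl := hun i hi hxy.symm
    rw [h0] at e2
    exact e2 Sym2.eq_swap
  · obtain rfl := hvn i hi hxy.symm
    rw [hn] at e4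
    exact e4 rfl
  · rcases lt_trichotomy i j with hlt | rfl | hlt
    · exact e3 (key i j hlt hj hxy)
    · exact G.loopless.irrefl _ hxy
    · exact e3 (Sym2.eq_swap ▸ key j i hlt hi hxy.symm)

theorem Joined.induce {U : Set V} {S : V → Prop} (hSU : ∀ t, S t → t ∈ U) {n : ℕ} {a b : V}
    (h : Joined G S n a b) :
    Joined (G.induce U) (fun t => S t.1) n ⟨a, hSU a h.left⟩ ⟨b, hSU b h.right⟩ := by
  obtain ⟨p, hp, h⟩ := h
  induction p generalizing n with
  | nil => subst hp; exact .refl (P := fun t : U => S t.1) (h _ (by simp))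
  | cons hadj p ih =>
    subst hp
    refine .cons (v := ⟨_, hSU _ (h _ (by simp))⟩) ?_ (h _ (by simp)) (ih rfl ?_)
    · simpa using hadj
    · intro t ht
      exact h t (by simp [ht])

/-- The triangle property of cycles in an induced chordal subgraph. -/
theorem exists_common_neighbor {U : Set V} (hU : IsChordal (G.induce U)) {S : V → Prop}
    (hSU : ∀ t, S t → t ∈ U) {u v a b : V} {n : ℕ} (huU : u ∈ U) (hvU : v ∈ U)
    (huv : G.Adj u v) (hu : ¬ S u) (hv : ¬ S v) (hab : Joined G S n a b)
    (hua : G.Adj u a) (hvb : G.Adj v b) : ∃ s, S s ∧ G.Adj u s ∧ G.Adj v s := by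
  obtain ⟨s, h1, h2, h3⟩ := hU.exists_common_neighbor (S := fun t : U => S t.1) (u := ⟨u, huU⟩)
    (v := ⟨v, hvU⟩) (by simpa using huv) hu hv (hab.induce hSU) (by simpa using hua)
    (by simpa using hvb)
  exact ⟨s.1, h1, by simpa using h2, by simpa using h3⟩

/-- In a chordal graph, the neighbours of a vertex on an induced path are consecutive. -/
theorem IsInducedPath.adj_of_between {U : Set V} (hU : IsChordal (G.induce U)) {P : V → Prop}
    (hPU : ∀ t, P t → t ∈ U) {f : ℕ → V} {n : ℕ} {u v : V} (hf : IsInducedPath G P f n u v)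
    {h : V} (hh : h ∈ U) (hne : ∀ i ≤ n, h ≠ f i) {i j k : ℕ} (hik : i ≤ k) (hkj : k ≤ j)
    (hj : j ≤ n) (hi : G.Adj h (f i)) (hj' : G.Adj h (f j)) : G.Adj h (f k) := by
  classical
  by_contra hk
  have hik' : i < k := lt_of_le_of_ne hik (by rintro rfl; exact hk hi)
  have hkj' : k < j := lt_of_le_of_ne hkj (by rintro rfl; exact hk hj')
  have hex : ∃ t, k ≤ t ∧ t ≤ n ∧ G.Adj h (f t) := ⟨j, hkj, hj, hj'⟩
  obtain ⟨hb1, hb2, hb3⟩ := Nat.find_spec hex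
  have hbmin := fun m hm => Nat.find_min hex (m := m) hm
  generalize Nat.find hex = b at *
  have hkb : k < b := lt_of_le_of_ne hb1 (by rintro rfl; exact hk hb3)
  -- Counting backwards from `k` turns the last neighbour before `k` into a least element. With `b`
  -- it bounds a gap in the neighbourhood of `h`, and the edge from `h` to the lower end of the gap
  -- lies in no triangle of the resulting cycle.
  have hex' : ∃ t, t ≤ k ∧ G.Adj h (f (k - t)) := ⟨k - i, by omega, by
    rwa [show k - (k - i) = i by omega]⟩
  obtain ⟨hs1, hs2⟩ := Nat.find_spec hex'
  have hamin := fun m hm => Nat.find_min hex' (m := m) hm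
  generalize Nat.find hex' = s at *
  have hs : s ≠ 0 := by rintro rfl; exact hk (by simpa using hs2)
  have hna : ∀ t, k - s < t → t < b → ¬ G.Adj h (f t) := by
    intro t h1 h2 h3
    rcases le_total k t with h4 | h4
    · exact hbmin t h2 ⟨h4, by omega, h3⟩
    · exact hamin (k - t) (by omega) ⟨by omega, by rwa [show k - (k - t) = t by omega]⟩
  obtain ⟨x, ⟨t, h1, h2, rfl⟩, h3, h4⟩ := exists_common_neighbor hU
    (S := fun x => ∃ t, k - s < t ∧ t ≤ b ∧ f t = x)
    (by rintro _ ⟨t, -, ht, rfl⟩; exact hPU _ (hf.mem t (by omega)))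
    (u := h) (v := f (k - s)) hh (hPU _ (hf.mem _ (by omega))) hs2
    (by rintro ⟨t, -, ht, he⟩; exact hne t (by omega) he.symm)
    (by rintro ⟨t, ht', ht, he⟩; have := hf.inj _ _ (by omega) (by omega) he; omega)
    (hf.joined (k - s + 1) b (by omega) hb2 (fun t h1 h2 => ⟨t, by omega, h2, rfl⟩)).symm
    hb3 (hf.adj_succ (by omega))
  have htb : t = b := by
    by_contra hne
    exact hna t h1 (by omega) h3
  have := (hf.adj _ _ (by omega) (by omega)).1 h4
  omega

/-! ### Recognising the seven kinds of induced subgraphs -/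

theorem isIndContained_of_fin {n : ℕ} {H : SimpleGraph (Fin n)} (f : Fin n → V)
    (hadj : ∀ i j, i < j → H.Adj i j → G.Adj (f i) (f j))
    (hfar : ∀ i j, i < j → ¬ H.Adj i j → Far G (f i) (f j)) : H.IsIndContained G := by
  have hne : ∀ i j, i < j → f i ≠ f j := fun i j hij => by
    by_cases h : H.Adj i j
    exacts [(hadj i j hij h).ne, (hfar i j hij h).1]
  have hiff : ∀ i j, i < j → (G.Adj (f i) (f j) ↔ H.Adj i j) := fun i j hij =>
    ⟨fun h => by by_contra hc; exact (hfar i j hij hc).2 h, hadj i j hij⟩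
  refine ⟨⟨⟨f, fun i j h => ?_⟩, fun {i j} => ?_⟩⟩
  · rcases lt_trichotomy i j with hlt | heq | hlt
    exacts [absurd h (hne i j hlt), heq, absurd h.symm (hne j i hlt)]
  · change G.Adj (f i) (f j) ↔ H.Adj i j
    rcases lt_trichotomy i j with hlt | rfl | hlt
    · exact hiff i j hlt
    · simp
    · rw [G.adj_comm, H.adj_comm]
      exact hiff j i hlt

theorem graphE_isIndContained {c a₁ a₂ a₃ b₁ b₂ b₃ : V}
    (h₁ : G.Adj c a₁) (h₂ : G.Adj c a₂) (h₃ : G.Adj c a₃)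
    (k₁ : G.Adj a₁ b₁) (k₂ : G.Adj a₂ b₂) (k₃ : G.Adj a₃ b₃)
    (c₁ : Far G c b₁) (c₂ : Far G c b₂) (c₃ : Far G c b₃)
    (a₁₂ : Far G a₁ a₂) (a₁₃ : Far G a₁ a₃) (a₂₃ : Far G a₂ a₃)
    (m₁₂ : Far G a₁ b₂) (m₁₃ : Far G a₁ b₃) (m₂₁ : Far G a₂ b₁) (m₂₃ : Far G a₂ b₃)
    (m₃₁ : Far G a₃ b₁) (m₃₂ : Far G a₃ b₂)
    (b₁₂ : Far G b₁ b₂) (b₁₃ : Far G b₁ b₃) (b₂₃ : Far G b₂ b₃) :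
    graphE.IsIndContained G := by
  refine isIndContained_of_fin ![c, a₁, a₂, a₃, b₁, b₂, b₃] ?_ ?_ <;>
    simp [Fin.forall_fin_succ, graphE, *]

/-- The neighbours of the hub form a segment with `m` edges, and the two path vertices just outside
it serve as pendants; the bounds on `s` and `s + m` say that they exist. -/
theorem graphD_isIndContained {P : V → Prop} {q : ℕ → V} {n : ℕ} {u v x h : V}
    (hq : IsInducedPath G P q n u v) {s m : ℕ} (hs : 1 ≤ s) (hm : s + m + 1 ≤ n)
    (hxh : G.Adj x h) (hx : ∀ t ≤ n, Far G x (q t))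
    (hh : ∀ t ≤ n, (G.Adj h (q t) ↔ s ≤ t ∧ t ≤ s + m)) : (graphD m).IsIndContained G := by
  let φ : VertexD m → V
    | .a => x
    | .b => q (s - 1)
    | .c => q (s + m + 1)
    | .h => h
    | .p i => q (s + i)
  have hhq : ∀ t ≤ n, h ≠ q t := fun t ht he => (hx t ht).2 (he ▸ hxh)
  have hhq' := fun t ht => (hhq t ht).symm
  have hx1 := fun t ht => (hx t ht).1
  have hx2 := fun t ht => (hx t ht).2
  have hx3 := fun t ht => (hx t ht).symm.1
  have hx4 := fun t ht => (hx t ht).symm.2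
  have hh' : ∀ t ≤ n, (G.Adj (q t) h ↔ s ≤ t ∧ t ≤ s + m) := fun t ht => by
    rw [G.adj_comm, hh t ht]
  have hqa := hq.adj
  have hqi := hq.inj
  have h1 := hxh.symm
  have h2 := hxh.ne
  have h3 := hxh.ne'
  refine ⟨⟨⟨φ, fun i j hij => ?_⟩, fun {i j} => ?_⟩⟩
  · cases i <;> cases j <;> simp only [φ] at hij <;> grind
  · change G.Adj (φ i) (φ j) ↔ _
    cases i <;> cases j <;> simp [graphD, edgeD, φ] <;> grind

/-- The configuration of family d) with a segment of one edge, which alone is not forbidden; the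
extra far vertex `w` supplies the isolated vertex of a). -/
theorem graphA_isIndContained {P : V → Prop} {q : ℕ → V} {n : ℕ} {u v x h w : V}
    (hq : IsInducedPath G P q n u v) {s : ℕ} (hs : 1 ≤ s) (hm : s + 1 + 1 ≤ n)
    (hxh : G.Adj x h) (hx : ∀ t ≤ n, Far G x (q t))
    (hh : ∀ t ≤ n, (G.Adj h (q t) ↔ s ≤ t ∧ t ≤ s + 1))
    (hwx : Far G w x) (hwh : Far G w h) (hw : ∀ t ≤ n, Far G w (q t)) :
    graphA.IsIndContained G := by
  have hhq : ∀ t ≤ n, ¬ (s ≤ t ∧ t ≤ s + 1) → Far G h (q t) := fun t ht h' =>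
    ⟨fun he => (hx t ht).2 (he ▸ hxh), fun ha => h' ((hh t ht).1 ha)⟩
  have e₁ := (hh s (by omega)).2 (by omega)
  have e₂ := (hh (s + 1) (by omega)).2 (by omega)
  have e₃ : G.Adj (q s) (q (s + 1)) := hq.adj_succ (by omega)
  have e₄ : G.Adj (q (s + 1)) (q (s + 1 + 1)) := hq.adj_succ (by omega)
  have e₅ : G.Adj (q s) (q (s - 1)) := (hq.adj _ _ (by omega) (by omega)).2 (by omega)
  have f₁ := hhq (s - 1) (by omega) (by omega)
  have f₂ := hhq (s + 1 + 1) (by omega) (by omega)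
  have f₃ := (hx s (by omega)).symm
  have f₄ := (hx (s + 1) (by omega)).symm
  have f₅ := hx (s - 1) (by omega)
  have f₆ := hx (s + 1 + 1) (by omega)
  have f₇ : Far G (q s) (q (s + 1 + 1)) := hq.far (by omega) (by omega) (by omega)
  have f₈ : Far G (q (s + 1)) (q (s - 1)) := hq.far (by omega) (by omega) (by omega)
  have f₉ : Far G (q (s - 1)) (q (s + 1 + 1)) := hq.far (by omega) (by omega) (by omega)
  have w₁ := (hw s (by omega)).symm
  have w₂ := (hw (s + 1) (by omega)).symm
  have w₃ := (hw (s - 1) (by omega)).symm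
  have w₄ := (hw (s + 1 + 1) (by omega)).symm
  have w₅ := hwx.symm
  have w₆ := hwh.symm
  have e₆ := hxh.symm
  refine isIndContained_of_fin ![h, q s, q (s + 1), x, q (s - 1), q (s + 1 + 1), w] ?_ ?_ <;>
    simp [Fin.forall_fin_succ, graphA, *]

theorem graphB_isIndContained {p₀ p₁ p₂ p₃ p₄ h x w : V}
    (e₁ : G.Adj p₀ p₁) (e₂ : G.Adj p₁ p₂) (e₃ : G.Adj p₂ p₃) (e₄ : G.Adj p₃ p₄)
    (h₀ : G.Adj p₀ h) (h₁ : G.Adj p₁ h) (h₂ : G.Adj p₂ h) (h₃ : G.Adj p₃ h) (h₄ : G.Adj p₄ h)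
    (hx : G.Adj p₂ x)
    (f₁ : Far G p₀ p₂) (f₂ : Far G p₀ p₃) (f₃ : Far G p₀ p₄) (f₄ : Far G p₁ p₃)
    (f₅ : Far G p₁ p₄) (f₆ : Far G p₂ p₄)
    (x₀ : Far G p₀ x) (x₁ : Far G p₁ x) (x₃ : Far G p₃ x) (x₄ : Far G p₄ x) (xh : Far G h x)
    (w₀ : Far G p₀ w) (w₁ : Far G p₁ w) (w₂ : Far G p₂ w) (w₃ : Far G p₃ w) (w₄ : Far G p₄ w)
    (wh : Far G h w) (wx : Far G x w) : graphB.IsIndContained G := by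
  refine isIndContained_of_fin ![p₀, p₁, p₂, p₃, p₄, h, x, w] ?_ ?_ <;>
    simp [Fin.forall_fin_succ, graphB, *]

/-- The neighbourhoods of `l` and `r` are an initial and a final segment of the path. Their overlap
is the path of family c), and the vertices just before and after it are the two corners. -/
theorem graphC_isIndContained {P : V → Prop} {q : ℕ → V} {n : ℕ} {u v x l r w : V}
    (hq : IsInducedPath G P q n u v) {s k : ℕ} (hs : 1 ≤ s) (hk₁ : 1 ≤ k) (hk : s + k ≤ n)
    (hxl : G.Adj x l) (hxr : G.Adj x r) (hlr : G.Adj l r) (hx : ∀ t ≤ n, Far G x (q t))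
    (hl : ∀ t ≤ n, (G.Adj l (q t) ↔ t < s + k)) (hr : ∀ t ≤ n, (G.Adj r (q t) ↔ s ≤ t))
    (hwx : Far G w x) (hwl : Far G w l) (hwr : Far G w r) (hw : ∀ t ≤ n, Far G w (q t)) :
    (graphC k).IsIndContained G := by
  let φ : VertexC k → V
    | .a => x
    | .b => q (s - 1)
    | .c => q (s + k)
    | .d => w
    | .l => l
    | .r => r
    | .p i => q (s + i)
  have hlq : ∀ t ≤ n, l ≠ q t := fun t ht he => (hx t ht).2 (he ▸ hxl)
  have hrq : ∀ t ≤ n, r ≠ q t := fun t ht he => (hx t ht).2 (he ▸ hxr)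
  have hlq' := fun t ht => (hlq t ht).symm
  have hrq' := fun t ht => (hrq t ht).symm
  have hx1 := fun t ht => (hx t ht).1
  have hx2 := fun t ht => (hx t ht).2
  have hx3 := fun t ht => (hx t ht).symm.1
  have hx4 := fun t ht => (hx t ht).symm.2
  have hw1 := fun t ht => (hw t ht).1
  have hw2 := fun t ht => (hw t ht).2
  have hw3 := fun t ht => (hw t ht).symm.1
  have hw4 := fun t ht => (hw t ht).symm.2
  have hl' : ∀ t ≤ n, (G.Adj (q t) l ↔ t < s + k) := fun t ht => by rw [G.adj_comm, hl t ht]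
  have hr' : ∀ t ≤ n, (G.Adj (q t) r ↔ s ≤ t) := fun t ht => by rw [G.adj_comm, hr t ht]
  have hqa := hq.adj
  have hqi := hq.inj
  have h1 := hxl.symm
  have h2 := hxl.ne
  have h3 := hxl.ne'
  have h4 := hxr.symm
  have h5 := hxr.ne
  have h6 := hxr.ne'
  have h7 := hlr.symm
  have h8 := hlr.ne
  have h9 := hlr.ne'
  obtain ⟨wx1, wx2⟩ := hwx
  obtain ⟨wl1, wl2⟩ := hwl
  obtain ⟨wr1, wr2⟩ := hwr
  have wx3 : ¬ G.Adj x w := fun h => wx2 h.symm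
  have wl3 : ¬ G.Adj l w := fun h => wl2 h.symm
  have wr3 : ¬ G.Adj r w := fun h => wr2 h.symm
  refine ⟨⟨⟨φ, fun i j hij => ?_⟩, fun {i j} => ?_⟩⟩
  · cases i <;> cases j <;> simp only [φ] at hij <;> grind
  · change G.Adj (φ i) (φ j) ↔ _
    cases i <;> cases j <;> simp [graphC, edgeC, φ] <;> grind

theorem graphF_isIndContained {a₁ a₂ c b₁ b₂ d e : V}
    (h₁₂ : G.Adj a₁ a₂) (h₁ : G.Adj a₁ c) (h₂ : G.Adj a₂ c)
    (k₁ : G.Adj a₁ b₁) (k₂ : G.Adj a₂ b₂) (hd : G.Adj c d) (he : G.Adj d e)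
    (c₁ : Far G c b₁) (c₂ : Far G c b₂) (ce : Far G c e)
    (m₁₂ : Far G a₁ b₂) (m₂₁ : Far G a₂ b₁) (b₁₂ : Far G b₁ b₂)
    (d₁ : Far G a₁ d) (d₂ : Far G a₂ d) (e₁ : Far G a₁ e) (e₂ : Far G a₂ e)
    (bd₁ : Far G b₁ d) (bd₂ : Far G b₂ d) (be₁ : Far G b₁ e) (be₂ : Far G b₂ e) :
    graphF.IsIndContained G := by
  refine isIndContained_of_fin ![a₁, a₂, c, b₁, b₂, d, e] ?_ ?_ <;>
    simp [Fin.forall_fin_succ, graphF, *]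

theorem graphG_isIndContained {c a₁ a₂ a₃ b₁ b₂ b₃ : V}
    (h₁ : G.Adj a₁ c) (h₂ : G.Adj a₂ c) (h₃ : G.Adj a₃ c)
    (k₁ : G.Adj a₁ b₁) (k₂ : G.Adj a₂ b₂) (k₃ : G.Adj a₃ b₃)
    (c₁ : Far G c b₁) (c₂ : Far G c b₂) (c₃ : Far G c b₃)
    (a₁₂ : G.Adj a₁ a₂) (a₁₃ : G.Adj a₁ a₃) (a₂₃ : G.Adj a₂ a₃)
    (m₁₂ : Far G a₁ b₂) (m₁₃ : Far G a₁ b₃) (m₂₁ : Far G a₂ b₁) (m₂₃ : Far G a₂ b₃)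
    (m₃₁ : Far G a₃ b₁) (m₃₂ : Far G a₃ b₂)
    (b₁₂ : Far G b₁ b₂) (b₁₃ : Far G b₁ b₃) (b₂₃ : Far G b₂ b₃) :
    graphG.IsIndContained G := by
  refine isIndContained_of_fin ![a₁, a₂, a₃, c, b₁, b₂, b₃] ?_ ?_ <;>
    simp [Fin.forall_fin_succ, graphG, *]

/-! ### Neighbourhoods on induced paths far from a fixed vertex -/

theorem mem_compl_closedNeighborSet {v t : V} : t ∈ (closedNeighborSet G v)ᶜ ↔ Far G v t := by
  simp [closedNeighborSet, Far, eq_comm]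

/-- The neighbours of a vertex that is adjacent to the first vertex of an induced path, but not to
the last one, form an initial segment of the path. -/
theorem IsInducedPath.exists_adj_iff_le {U : Set V} (hU : IsChordal (G.induce U)) {P : V → Prop}
    (hPU : ∀ t, P t → t ∈ U) {f : ℕ → V} {n : ℕ} {u v : V} (hf : IsInducedPath G P f n u v)
    {h : V} (hh : h ∈ U) (hne : ∀ i ≤ n, h ≠ f i) (h0 : G.Adj h (f 0)) (hn : ¬ G.Adj h (f n)) :
    ∃ i < n, ∀ t ≤ n, (G.Adj h (f t) ↔ t ≤ i) := by
  classical
  have hex : ∃ i, ¬ G.Adj h (f i) := ⟨n, hn⟩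
  have hs := Nat.find_spec hex
  have hmin := fun m hm => Nat.find_min hex (m := m) hm
  have hle := Nat.find_min' hex hn
  generalize Nat.find hex = k at *
  have hk : k ≠ 0 := by rintro rfl; exact hs h0
  refine ⟨k - 1, by omega, fun t ht => ⟨fun ha => ?_, fun htk => ?_⟩⟩
  · by_contra hc
    exact hs (hf.adj_of_between hU hPU hh hne (Nat.zero_le k) (by omega) ht h0 ha)
  · by_contra hc
    exact hmin t (by omega) hc

/-- Two induced paths with a common start are anticomplete to each other apart from that start
when their second vertices are distinct and nonadjacent. -/
theorem IsInducedPath.far_of_far {U : Set V} (hU : IsChordal (G.induce U)) {P Q : V → Prop}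
    (hPU : ∀ t, P t → t ∈ U) (hQU : ∀ t, Q t → t ∈ U) {f g : ℕ → V} {a b : ℕ} {w x y : V}
    (hf : IsInducedPath G P f a w x) (hg : IsInducedPath G Q g b w y)
    (hfg : Far G (f 1) (g 1)) {i j : ℕ} (hi : 1 ≤ i) (hia : i ≤ a) (hj : 1 ≤ j) (hjb : j ≤ b) :
    Far G (f i) (g j) := by
  have hw : ∀ t ≤ a, G.Adj w (f t) → t = 1 := fun t ht h => by
    rw [← hf.start, hf.adj 0 t (by omega) ht] at h
    omega
  have hw' : ∀ t ≤ b, G.Adj w (g t) → t = 1 := fun t ht h => by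
    rw [← hg.start, hg.adj 0 t (by omega) ht] at h
    omega
  have hwf : G.Adj w (f 1) := hf.start ▸ hf.adj_succ (by omega : 0 < a)
  have hwg : G.Adj w (g 1) := hg.start ▸ hg.adj_succ (by omega : 0 < b)
  have hfg' : ∀ t ≤ b, f 1 ≠ g t := fun t ht he => by
    have := hw' t ht (he ▸ hwf)
    subst this
    exact hfg.1 he
  have hwf' : ∀ t, 1 ≤ t → t ≤ a → f t ≠ w := fun t ht hta he => by
    have := hf.inj 0 t (by omega) hta (hf.start.trans he.symm)
    omega
  have hwg' : ∀ t, 1 ≤ t → t ≤ b → g t ≠ w := fun t ht hta he => by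
    have := hg.inj 0 t (by omega) hta (hg.start.trans he.symm)
    omega
  -- `S` holds the rest of a closed walk through the edge from `w` to `f 1`. The only neighbour of
  -- `w` in `S` is `g 1`, which is far from `f 1`, so that edge would lie in no triangle.
  let S : V → Prop := fun v => (∃ t, 2 ≤ t ∧ t ≤ i ∧ f t = v) ∨ (∃ t, 1 ≤ t ∧ t ≤ b ∧ g t = v)
  have hSU : ∀ t, S t → t ∈ U := by
    rintro _ (⟨t, _, ht, rfl⟩ | ⟨t, _, ht, rfl⟩)
    exacts [hPU _ (hf.mem t (by omega)), hQU _ (hg.mem t ht)]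
  have hSw : ¬ S w := by
    rintro (⟨t, h, ht, he⟩ | ⟨t, h, ht, he⟩)
    exacts [hwf' t (by omega) (by omega) he, hwg' t h ht he]
  have hSf : ¬ S (f 1) := by
    rintro (⟨t, h, ht, he⟩ | ⟨t, h, ht, he⟩)
    · have := hf.inj _ _ (by omega) (by omega) he
      omega
    · exact hfg' t ht he.symm
  have hgj : Joined G S (j - 1) (g 1) (g j) :=
    hg.joined 1 j hj hjb fun t h h' => Or.inr ⟨t, h, by omega, rfl⟩
  have key : ∀ n v, G.Adj (f 1) v → Joined G S n (g 1) v → False := by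
    intro n v hv hJ
    obtain ⟨s, hs, h1, h2⟩ := exists_common_neighbor hU hSU (u := w) (v := f 1)
      (hf.start ▸ hPU _ (hf.mem 0 (by omega))) (hPU _ (hf.mem 1 (by omega))) hwf hSw hSf hJ
      hwg hv
    obtain (⟨t, h, ht, rfl⟩ | ⟨t, h, ht, rfl⟩) := hs
    · have := hw t (by omega) h1
      omega
    · have := hw' t ht h1
      subst this
      exact hfg.2 h2
  rcases Nat.lt_or_ge 1 i with h1i | h1i
  · have hfi : Joined G S (i - 2) (f 2) (f i) :=
      hf.joined 2 i h1i hia fun t h h' => Or.inl ⟨t, h, by omega, rfl⟩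
    have h12 : G.Adj (f 1) (f 2) := hf.adj_succ (by omega)
    refine ⟨fun he => ?_, fun ha => ?_⟩
    · rw [he] at hfi
      exact key _ _ h12 (hgj.trans hfi.symm)
    · exact key _ _ h12 (hgj.trans (.cons ha.symm hgj.right hfi.symm))
  · obtain rfl : i = 1 := by omega
    exact ⟨hfg' j hjb, fun ha => key _ _ ha hgj⟩

/-- The new path runs backwards along `f` and then along `g`, so the common start has index `a`. -/
theorem IsInducedPath.concat {P Q : V → Prop} {f g : ℕ → V} {a b : ℕ} {w x y : V}
    (hf : IsInducedPath G P f a w x) (hg : IsInducedPath G Q g b w y)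
    (hfg : ∀ i j, 1 ≤ i → i ≤ a → 1 ≤ j → j ≤ b → Far G (f i) (g j)) :
    IsInducedPath G (fun t => P t ∨ Q t) (fun t => if t ≤ a then f (a - t) else g (t - a)) (a + b)
      x y := by
  have h00 : f 0 = g 0 := hf.start.trans hg.start.symm
  have hne : ∀ i j, i ≤ a → 1 ≤ j → j ≤ b → f i ≠ g j := fun i j hi hj hjb he => by
    rcases Nat.eq_zero_or_pos i with rfl | hi0
    · have := hg.inj 0 j (by omega) hjb (h00.symm.trans he)
      omega
    · exact (hfg i j hi0 hi hj hjb).1 he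
  have hadj : ∀ i j, i ≤ a → 1 ≤ j → j ≤ b → (G.Adj (f i) (g j) ↔ i = 0 ∧ j = 1) :=
    fun i j hi hj hjb => by
    rcases Nat.eq_zero_or_pos i with rfl | hi0
    · rw [h00, hg.adj 0 j (by omega) hjb]
      omega
    · have := (hfg i j hi0 hi hj hjb).2
      simp only [this, false_iff]
      omega
  refine ⟨by simpa using hf.finish, ?_, ?_, ?_, ?_⟩
  · rcases Nat.eq_zero_or_pos b with rfl | hb
    · simpa [h00] using hg.finish
    · simpa [show ¬ b = 0 by omega] using hg.finish
  · intro i hi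
    split_ifs with h
    exacts [Or.inl (hf.mem _ (by omega)), Or.inr (hg.mem _ (by omega))]
  · intro i j hi hj he
    split_ifs at he with h h' h'
    · have := hf.inj _ _ (by omega) (by omega) he
      omega
    · exact absurd he (hne _ _ (by omega) (by omega) (by omega))
    · exact absurd he.symm (hne _ _ (by omega) (by omega) (by omega))
    · have := hg.inj _ _ (by omega) (by omega) he
      omega
  · intro i j hi hj
    split_ifs with h h' h'
    · rw [hf.adj _ _ (by omega) (by omega)]
      omega
    · rw [hadj _ _ (by omega) (by omega) (by omega)]
      omega
    · rw [G.adj_comm, hadj _ _ (by omega) (by omega) (by omega)]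
      omega
    · rw [hg.adj _ _ (by omega) (by omega)]
      omega

/-- Vertices far from both `a` and `b`. -/
def FarBoth (G : SimpleGraph V) (a b t : V) : Prop := Far G a t ∧ Far G b t

/-- A graph of family d) from two anticomplete induced paths with a common start `w`, and a hub `v`
that is adjacent to `w` and has a pendant vertex `z`. -/
theorem exists_graphD_isIndContained (hG : IsNearlyChordal G) {f g : ℕ → V} {a b : ℕ}
    {w x y z v : V} (hf : IsInducedPath G (FarBoth G y z) f a w x)
    (hg : IsInducedPath G (FarBoth G x z) g b w y)
    (hfg : ∀ i j, 1 ≤ i → i ≤ a → 1 ≤ j → j ≤ b → Far G (f i) (g j))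
    (hvw : G.Adj v w) (hzv : G.Adj z v) (hxv : Far G x v) (hyv : Far G y v)
    (hb : 1 ≤ b) (ha : 1 ≤ a)
    (h2 : (G.Adj v (f 1) ∧ G.Adj v (g 1)) ∨ (2 ≤ b ∧ G.Adj v (g 2))) :
    ∃ m, 2 ≤ m ∧ (graphD m).IsIndContained G := by
  have hvf : ∀ t ≤ a, v ≠ f t := fun t ht he => (hf.mem t ht).2.2 (he ▸ hzv)
  have hvg : ∀ t ≤ b, v ≠ g t := fun t ht he => (hg.mem t ht).2.2 (he ▸ hzv)
  obtain ⟨i, hi, hi'⟩ := hf.exists_adj_iff_le (hG y)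
    (fun t ht => mem_compl_closedNeighborSet.2 ht.1) (mem_compl_closedNeighborSet.2 hyv) hvf
    (by rwa [hf.start]) (by rw [hf.finish]; exact hxv.symm.2)
  obtain ⟨j, hj, hj'⟩ := hg.exists_adj_iff_le (hG x)
    (fun t ht => mem_compl_closedNeighborSet.2 ht.1) (mem_compl_closedNeighborSet.2 hxv) hvg
    (by rwa [hg.start]) (by rw [hg.finish]; exact hyv.symm.2)
  have hij : 2 ≤ i + j := by
    rcases h2 with ⟨h, h'⟩ | ⟨h, h'⟩
    · have := (hi' 1 ha).1 h
      have := (hj' 1 hb).1 h'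
      omega
    · have := (hj' 2 h).1 h'
      omega
  -- Around index `a` the hub sees `i` steps along `f` and `j` along `g`; `i < a` and `j < b` leave
  -- a pendant on each side.
  refine ⟨i + j, hij, graphD_isIndContained (hf.concat hg hfg) (s := a - i) (h := v)
    (by omega) (by omega) hzv ?_ ?_⟩
  · intro t ht
    split_ifs
    exacts [(hf.mem _ (by omega)).2, (hg.mem _ (by omega)).2]
  · intro t ht
    split_ifs
    · rw [hi' _ (by omega)]
      omega
    · rw [hj' _ (by omega)]
      omega

/-! ### Blocking quadruples of star type -/

/-- A blocking quadruple of star type: `w` is joined to each of `x`, `y`, `z` by a walk that stays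
far from the other two. -/
structure IsStar (G : SimpleGraph V) (w x y z : V) (a b c : ℕ) : Prop where
  fst : Joined G (FarBoth G y z) a w x
  snd : Joined G (FarBoth G x z) b w y
  trd : Joined G (FarBoth G x y) c w z

theorem IsInducedPath.joined_self {P : V → Prop} {f : ℕ → V} {n : ℕ} {u v : V}
    (hf : IsInducedPath G P f n u v) : Joined G P n u v := by
  have := hf.joined 0 n (by omega) le_rfl (fun t _ ht => hf.mem t ht)
  rwa [hf.start, hf.finish] at this

theorem IsInducedPath.joined_from {P : V → Prop} {f : ℕ → V} {n : ℕ} {u v : V}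
    (hf : IsInducedPath G P f n u v) (i : ℕ) (hi : i ≤ n) : Joined G P (n - i) (f i) v := by
  have := hf.joined i n hi le_rfl (fun t _ ht => hf.mem t ht)
  rwa [hf.finish] at this

/-- A blocking quadruple of star type whose three walks are induced paths. -/
structure StarPaths (G : SimpleGraph V) (f g h : ℕ → V) (w x y z : V) (a b c : ℕ) : Prop where
  fst : IsInducedPath G (FarBoth G y z) f a w x
  snd : IsInducedPath G (FarBoth G x z) g b w y
  trd : IsInducedPath G (FarBoth G x y) h c w z

namespace StarPaths

variable {f g h : ℕ → V} {w x y z : V} {a b c : ℕ}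

theorem swap₁₂ (H : StarPaths G f g h w x y z a b c) : StarPaths G g f h w y x z b a c :=
  ⟨H.snd, H.fst, H.trd.mono fun _ => And.symm⟩

theorem swap₂₃ (H : StarPaths G f g h w x y z a b c) : StarPaths G f h g w x z y a c b :=
  ⟨H.fst.mono fun _ => And.symm, H.trd, H.snd⟩

theorem two_le (H : StarPaths G f g h w x y z a b c) : 2 ≤ a := by
  by_contra hc
  have h1 : Far G x w := H.snd.start ▸ (H.snd.mem 0 (by omega)).1
  obtain rfl | rfl : a = 0 ∨ a = 1 := by omega
  · exact h1.1 (H.fst.finish.symm.trans H.fst.start)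
  · have := H.fst.adj_succ (i := 0) (by omega)
    rw [H.fst.start, H.fst.finish] at this
    exact h1.2 this.symm

theorem adj_fst (H : StarPaths G f g h w x y z a b c) : G.Adj (f 1) w := by
  have := H.two_le
  have := H.fst.adj_succ (i := 0) (by omega)
  rw [H.fst.start] at this
  exact this.symm

variable {N : ℕ}

/-- Moving the centre to the common first vertex shortens two walks by one and lengthens the third
by one. -/
theorem of_first_eq (H : StarPaths G f g h w x y z a b c) (hN : a + b + c ≤ N)
    (ih : ∀ w x y z a b c, a + b + c < N → IsStar G w x y z a b c → ContainsForbidden G)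
    (h1 : f 1 = g 1) : ContainsForbidden G := by
  have ha := H.two_le
  have hb := H.swap₁₂.two_le
  refine ih (f 1) x y z (a - 1) (b - 1) (c + 1) (by omega)
    ⟨H.fst.joined_from 1 (by omega), h1 ▸ H.snd.joined_from 1 (by omega),
      .cons H.adj_fst ⟨?_, ?_⟩ H.trd.joined_self⟩
  · rw [h1]
    exact (H.snd.mem 1 (by omega)).1
  · exact (H.fst.mem 1 (by omega)).1

theorem far_of_far (hG : IsNearlyChordal G) (H : StarPaths G f g h w x y z a b c)
    (hfg : Far G (f 1) (g 1)) : ∀ i j, 1 ≤ i → i ≤ a → 1 ≤ j → j ≤ b → Far G (f i) (g j) :=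
  fun _ _ hi hia hj hjb => H.fst.far_of_far (hG z)
    (fun _ ht => mem_compl_closedNeighborSet.2 ht.2)
    (fun _ ht => mem_compl_closedNeighborSet.2 ht.2) H.snd hfg hi hia hj hjb

/-- If `h 1` is not next to `z`, it can be the new centre: the edge to `g 2` bypasses two steps of
`g`, and the lengths change by `+1`, `-1`, `-1`. If `c = 2`, then `h 1` is a hub with pendant `z`,
and its neighbours include `w` and `g 2` on the path formed by `f` and `g`. -/
theorem of_adj_second (hG : IsNearlyChordal G) (H : StarPaths G f g h w x y z a b c)
    (hN : a + b + c ≤ N)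
    (ih : ∀ w x y z a b c, a + b + c < N → IsStar G w x y z a b c → ContainsForbidden G)
    (hfg : Far G (f 1) (g 1)) (h2 : G.Adj (h 1) (g 2)) : ContainsForbidden G := by
  have ha := H.two_le
  have hb := H.swap₁₂.two_le
  have hc := H.swap₂₃.swap₁₂.two_le
  have hh1 := H.trd.mem 1 (by omega)
  have hw := H.swap₂₃.swap₁₂.adj_fst
  rcases Nat.lt_or_ge 2 c with hc3 | hc2
  · have hz : Far G z (h 1) := by
      rw [← H.trd.finish]
      exact H.trd.far (by omega) (by omega) (by omega)
    refine ih (h 1) x y z (a + 1) (b - 2 + 1) (c - 1) (by omega)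
      ⟨.cons hw ⟨hh1.2, hz⟩ H.fst.joined_self, .cons h2 ⟨hh1.1, hz⟩ (H.snd.joined_from 2 hb),
        H.trd.joined_from 1 (by omega)⟩
  · obtain rfl : c = 2 := by omega
    have hz : G.Adj z (h 1) := by
      rw [← H.trd.finish]
      exact (H.trd.adj_succ (i := 1) (by omega)).symm
    have := exists_graphD_isIndContained hG H.fst H.snd (H.far_of_far hG hfg) hw hz
      hh1.1 hh1.2 (by omega) (by omega) (Or.inr ⟨hb, h2⟩)
    simp [ContainsForbidden, this]

/-- When no adjacency to a second vertex allows the previous reduction, the triangle `w`, `g 1`, `h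
1` with pendants `g 2`, `h 2` and the pendant path `f 1`, `f 2` is f). -/
theorem of_one_adj (hG : IsNearlyChordal G) (H : StarPaths G f g h w x y z a b c)
    (hN : a + b + c ≤ N)
    (ih : ∀ w x y z a b c, a + b + c < N → IsStar G w x y z a b c → ContainsForbidden G)
    (hfg : Far G (f 1) (g 1)) (hfh : Far G (f 1) (h 1)) (hgh : G.Adj (g 1) (h 1)) :
    ContainsForbidden G := by
  have ha := H.two_le
  have hb := H.swap₁₂.two_le
  have hc := H.swap₂₃.swap₁₂.two_le
  by_cases h2 : G.Adj (h 1) (g 2)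
  · exact H.of_adj_second hG hN ih hfg h2
  by_cases h2' : G.Adj (g 1) (h 2)
  · exact H.swap₂₃.of_adj_second hG (by omega) ih hfh h2'
  have Hfg := H.far_of_far hG hfg
  have Hfh := H.swap₂₃.far_of_far hG hfh
  have hg12 : G.Adj (g 1) (g 2) := H.snd.adj_succ (by omega)
  have hh12 : G.Adj (h 1) (h 2) := H.trd.adj_succ (by omega)
  have wg : Far G w (g 2) := by
    rw [← H.snd.start]
    exact H.snd.far (by omega) (by omega) (by omega)
  have wh : Far G w (h 2) := by
    rw [← H.trd.start]
    exact H.trd.far (by omega) (by omega) (by omega)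
  have wf : Far G w (f 2) := by
    rw [← H.fst.start]
    exact H.fst.far (by omega) (by omega) (by omega)
  have hwg := H.swap₁₂.adj_fst
  have hwh := H.swap₂₃.swap₁₂.adj_fst
  have f1 : Far G (g 1) (h 2) := ⟨fun he => wh.2 (he ▸ hwg.symm), h2'⟩
  have f2 : Far G (h 1) (g 2) := ⟨fun he => wg.2 (he ▸ hwh.symm), h2⟩
  have f3 : Far G (g 2) (h 2) := by
    -- An edge between `g 2` and `h 2` would close a chordless four-cycle with `g 1` and `h 1`, all
    -- far from `x`.
    refine ⟨fun he => f1.2 (he ▸ hg12), fun hadj => ?_⟩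
    have U {t} (ht : Far G x t) := mem_compl_closedNeighborSet.2 ht
    have hx1 := (H.snd.mem 1 (by omega)).1
    have hx2 := (H.snd.mem 2 (by omega)).1
    have hx3 := (H.trd.mem 1 (by omega)).1
    have hx4 := (H.trd.mem 2 (by omega)).1
    obtain ⟨s, hs, h3, h4⟩ := exists_common_neighbor (hG x) (S := fun t => t = g 2 ∨ t = h 2)
      (by rintro t (rfl | rfl); exacts [U hx2, U hx4]) (U hx1) (U hx3) hgh
      (by rintro (he | he); exacts [hg12.ne he, f1.1 he])
      (by rintro (he | he); exacts [f2.1 he, hh12.ne he])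
      (.cons hadj (Or.inl rfl) (.refl (Or.inr rfl))) hg12 hh12
    rcases hs with rfl | rfl
    exacts [h2 h4, h2' h3]
  have := graphF_isIndContained hgh hwg hwh hg12 hh12 H.adj_fst.symm
    (H.fst.adj_succ (by omega)) wg wh wf f1 f2 f3
    (Hfg 1 1 le_rfl (by omega) le_rfl (by omega)).symm
    (Hfh 1 1 le_rfl (by omega) le_rfl (by omega)).symm
    (Hfg 2 1 (by omega) (by omega) le_rfl (by omega)).symm
    (Hfh 2 1 (by omega) (by omega) le_rfl (by omega)).symm
    (Hfg 1 2 (by omega) (by omega) (by omega) (by omega)).symm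
    (Hfh 1 2 (by omega) (by omega) (by omega) (by omega)).symm
    (Hfg 2 2 (by omega) (by omega) (by omega) (by omega)).symm
    (Hfh 2 2 (by omega) (by omega) (by omega) (by omega)).symm
  simp [ContainsForbidden, this]

/-- Recentring at `h 1` preserves the lengths of the first two walks and shortens the third, unless
`z` is adjacent to `h 1`; in that case `h 1` is the hub of a graph d) with pendant `z`. -/
theorem of_two_adj (hG : IsNearlyChordal G) (H : StarPaths G f g h w x y z a b c)
    (hN : a + b + c ≤ N)
    (ih : ∀ w x y z a b c, a + b + c < N → IsStar G w x y z a b c → ContainsForbidden G)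
    (hfg : Far G (f 1) (g 1)) (hfh : G.Adj (f 1) (h 1)) (hgh : G.Adj (g 1) (h 1)) :
    ContainsForbidden G := by
  have ha := H.two_le
  have hb := H.swap₁₂.two_le
  have hc := H.swap₂₃.swap₁₂.two_le
  have hh1 := H.trd.mem 1 (by omega)
  rcases Nat.lt_or_ge 2 c with hc3 | hc2
  · have hz : Far G z (h 1) := by
      rw [← H.trd.finish]
      exact H.trd.far (by omega) (by omega) (by omega)
    refine ih (h 1) x y z (a - 1 + 1) (b - 1 + 1) (c - 1) (by omega)
      ⟨.cons hfh.symm ⟨hh1.2, hz⟩ (H.fst.joined_from 1 (by omega)),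
        .cons hgh.symm ⟨hh1.1, hz⟩ (H.snd.joined_from 1 (by omega)),
        H.trd.joined_from 1 (by omega)⟩
  · obtain rfl : c = 2 := by omega
    have hz : G.Adj z (h 1) := by
      rw [← H.trd.finish]
      exact (H.trd.adj_succ (i := 1) (by omega)).symm
    have := exists_graphD_isIndContained hG H.fst H.snd (H.far_of_far hG hfg)
      H.swap₂₃.swap₁₂.adj_fst hz hh1.1 hh1.2 (by omega) (by omega)
      (Or.inl ⟨hfh.symm, hgh.symm⟩)
    simp [ContainsForbidden, this]

/-- If `a > 2`, then `f 1` is far from `x` and is a better centre: only the first length changes,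
and it drops. -/
theorem length_eq_two (H : StarPaths G f g h w x y z a b c) (hN : a + b + c ≤ N)
    (ih : ∀ w x y z a b c, a + b + c < N → IsStar G w x y z a b c → ContainsForbidden G)
    (hfg : G.Adj (f 1) (g 1)) (hfh : G.Adj (f 1) (h 1)) : ContainsForbidden G ∨ a = 2 := by
  have ha := H.two_le
  have hb := H.swap₁₂.two_le
  have hc := H.swap₂₃.swap₁₂.two_le
  rcases Nat.lt_or_ge 2 a with ha3 | ha2
  · have hx : Far G x (f 1) := by
      rw [← H.fst.finish]
      exact H.fst.far (by omega) (by omega) (by omega)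
    have hf1 := H.fst.mem 1 (by omega)
    exact Or.inl <| ih (f 1) x y z (a - 1) (b - 1 + 1) (c - 1 + 1) (by omega)
      ⟨H.fst.joined_from 1 (by omega), .cons hfg ⟨hx, hf1.2⟩ (H.snd.joined_from 1 (by omega)),
        .cons hfh ⟨hx, hf1.1⟩ (H.trd.joined_from 1 (by omega))⟩
  · right; omega

/-- All three lengths are two, so the centre and the first vertices form the complete graph of g),
with pendants `x`, `y`, `z`. -/
theorem of_three_adj (H : StarPaths G f g h w x y z a b c) (hN : a + b + c ≤ N)
    (ih : ∀ w x y z a b c, a + b + c < N → IsStar G w x y z a b c → ContainsForbidden G)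
    (hfg : G.Adj (f 1) (g 1)) (hfh : G.Adj (f 1) (h 1)) (hgh : G.Adj (g 1) (h 1)) :
    ContainsForbidden G := by
  obtain hF | rfl := H.length_eq_two hN ih hfg hfh
  · exact hF
  obtain hF | rfl := H.swap₁₂.length_eq_two (by omega) ih hfg.symm hgh
  · exact hF
  obtain hF | rfl := H.swap₂₃.swap₁₂.length_eq_two (by omega) ih hfh.symm hgh.symm
  · exact hF
  have e₁ := H.fst.adj_succ (i := 1) (by omega)
  have e₂ := H.snd.adj_succ (i := 1) (by omega)
  have e₃ := H.trd.adj_succ (i := 1) (by omega)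
  have f₀ := H.fst.mem 0 (by omega)
  have f₁ := H.fst.mem 1 (by omega)
  have f₂ := H.fst.mem 2 (by omega)
  have g₀ := H.snd.mem 0 (by omega)
  have g₁ := H.snd.mem 1 (by omega)
  have g₂ := H.snd.mem 2 (by omega)
  have h₁ := H.trd.mem 1 (by omega)
  simp only [one_add_one_eq_two, H.fst.finish, H.snd.finish, H.trd.finish, H.fst.start,
    H.snd.start] at e₁ e₂ e₃ f₀ f₁ f₂ g₀ g₁ g₂
  have := graphG_isIndContained H.adj_fst H.swap₁₂.adj_fst H.swap₂₃.swap₁₂.adj_fst e₁ e₂ e₃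
    g₀.1.symm f₀.1.symm f₀.2.symm hfg hfh hgh f₁.1.symm f₁.2.symm g₁.1.symm g₁.2.symm h₁.1.symm
    h₁.2.symm f₂.1.symm f₂.2.symm g₂.2.symm
  simp [ContainsForbidden, this]

/-- The three paths are pairwise anticomplete apart from `w`, so their first two steps form the tree
e). -/
theorem of_no_adj (hG : IsNearlyChordal G) (H : StarPaths G f g h w x y z a b c)
    (hfg : Far G (f 1) (g 1)) (hfh : Far G (f 1) (h 1)) (hgh : Far G (g 1) (h 1)) :
    ContainsForbidden G := by
  have ha := H.two_le
  have hb := H.swap₁₂.two_le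
  have hc := H.swap₂₃.swap₁₂.two_le
  have Hfg := H.far_of_far hG hfg
  have Hfh := H.swap₂₃.far_of_far hG hfh
  have Hgh := H.swap₁₂.swap₂₃.far_of_far hG hgh
  have wg : Far G w (g 2) := by
    rw [← H.snd.start]
    exact H.snd.far (by omega) (by omega) (by omega)
  have wh : Far G w (h 2) := by
    rw [← H.trd.start]
    exact H.trd.far (by omega) (by omega) (by omega)
  have wf : Far G w (f 2) := by
    rw [← H.fst.start]
    exact H.fst.far (by omega) (by omega) (by omega)
  have l1 : 1 ≤ 1 := le_rfl
  have l2 : 1 ≤ 2 := by omega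
  have a1 : 1 ≤ a := by omega
  have b1 : 1 ≤ b := by omega
  have c1 : 1 ≤ c := by omega
  have := graphE_isIndContained H.adj_fst.symm H.swap₁₂.adj_fst.symm
    H.swap₂₃.swap₁₂.adj_fst.symm (H.fst.adj_succ (by omega)) (H.snd.adj_succ (by omega))
    (H.trd.adj_succ (by omega)) wf wg wh hfg hfh hgh
    (Hfg 1 2 l1 a1 l2 hb) (Hfh 1 2 l1 a1 l2 hc) (Hfg 2 1 l2 ha l1 b1).symm (Hgh 1 2 l1 b1 l2 hc)
    (Hfh 2 1 l2 ha l1 c1).symm (Hgh 2 1 l2 hb l1 c1).symm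
    (Hfg 2 2 l2 ha l2 hb) (Hfh 2 2 l2 ha l2 hc) (Hgh 2 2 l2 hb l2 hc)
  simp [ContainsForbidden, this]

end StarPaths

theorem IsStar.containsForbidden (hG : IsNearlyChordal G) {w x y z : V} {a b c : ℕ}
    (H : IsStar G w x y z a b c) : ContainsForbidden G := by
  generalize hN : a + b + c = N
  induction N using Nat.strong_induction_on generalizing w x y z a b c with
  | _ N ih =>
    have ih : ∀ w x y z a b c, a + b + c < N → IsStar G w x y z a b c → ContainsForbidden G :=
      fun w x y z a b c hlt H => ih _ hlt H rfl
    rcases H.fst.shorter_or_isInducedPath with ⟨a', ha', h'⟩ | ⟨f, hf⟩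
    · exact ih w x y z a' b c (by omega) ⟨h', H.snd, H.trd⟩
    rcases H.snd.shorter_or_isInducedPath with ⟨b', hb', h'⟩ | ⟨g, hg⟩
    · exact ih w x y z a b' c (by omega) ⟨H.fst, h', H.trd⟩
    rcases H.trd.shorter_or_isInducedPath with ⟨c', hc', h'⟩ | ⟨h, hh⟩
    · exact ih w x y z a b c' (by omega) ⟨H.fst, H.snd, h'⟩
    have S : StarPaths G f g h w x y z a b c := ⟨hf, hg, hh⟩
    by_cases efg : f 1 = g 1
    · exact S.of_first_eq (by omega) ih efg
    by_cases efh : f 1 = h 1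
    · exact S.swap₂₃.of_first_eq (by omega) ih efh
    by_cases egh : g 1 = h 1
    · exact S.swap₁₂.swap₂₃.of_first_eq (by omega) ih egh
    by_cases afg : G.Adj (f 1) (g 1) <;> by_cases afh : G.Adj (f 1) (h 1) <;>
      by_cases agh : G.Adj (g 1) (h 1)
    · exact S.of_three_adj (by omega) ih afg afh agh
    · exact S.swap₁₂.swap₂₃.of_two_adj hG (by omega) ih ⟨egh, agh⟩ afg.symm afh.symm
    · exact S.swap₂₃.of_two_adj hG (by omega) ih ⟨efh, afh⟩ afg agh.symm
    · exact S.swap₂₃.swap₁₂.of_one_adj hG (by omega) ih ⟨Ne.symm efh, fun h => afh h.symm⟩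
        ⟨Ne.symm egh, fun h => agh h.symm⟩ afg
    · exact S.of_two_adj hG (by omega) ih ⟨efg, afg⟩ afh agh
    · exact S.swap₁₂.of_one_adj hG (by omega) ih ⟨Ne.symm efg, fun h => afg h.symm⟩
        ⟨egh, agh⟩ afh
    · exact S.of_one_adj hG (by omega) ih ⟨efg, afg⟩ ⟨efh, afh⟩ agh
    · exact S.of_no_adj hG ⟨efg, afg⟩ ⟨efh, afh⟩ ⟨egh, agh⟩

/-! ### Asteroidal triples far from a fourth vertex -/

/-- Outcome of a vertex `v`, with a neighbour `x` far from the induced path `f`, having a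
neighbour on `f`: a forbidden subgraph, or a unique neighbour on `f` next to an end of `f`. -/
theorem containsForbidden_or_unique_neighbor {w x v y z : V} (hU : IsChordal
      (G.induce (closedNeighborSet G w)ᶜ)) {f : ℕ → V} {k : ℕ}
    (hf : IsInducedPath G (FarBoth G w x) f k y z) (hxv : G.Adj x v) (hvy : Far G v y)
    (hvz : Far G v z) (hwv : Far G w v) (hwx : Far G w x) (hex : ∃ i ≤ k, G.Adj v (f i)) :
    ContainsForbidden G ∨ ∃ i, (i = 1 ∨ i + 1 = k) ∧ ∀ t ≤ k, (G.Adj v (f t) ↔ t = i) := by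
  classical
  have hne : ∀ t ≤ k, v ≠ f t := fun t ht he => (hf.mem t ht).2.2 (he ▸ hxv)
  have hbet := fun (i j t : ℕ) => hf.adj_of_between hU
    (fun t ht => mem_compl_closedNeighborSet.2 ht.1) (mem_compl_closedNeighborSet.2 hwv) hne
    (i := i) (j := j) (k := t)
  obtain ⟨s, e, hse, hek, hs, he, hiff⟩ : ∃ s e, s ≤ e ∧ e ≤ k ∧ G.Adj v (f s) ∧ G.Adj v (f e) ∧
      ∀ t ≤ k, (G.Adj v (f t) ↔ s ≤ t ∧ t ≤ e) := by
    obtain ⟨i, hi, hvi⟩ := hex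
    have hex : ∃ i, G.Adj v (f i) := ⟨i, hvi⟩
    have he := Nat.findGreatest_spec (P := fun t => G.Adj v (f t)) hi hvi
    have hle := Nat.findGreatest_le (P := fun t => G.Adj v (f t)) k
    have hmin := Nat.find_min' hex he
    refine ⟨_, _, hmin, hle, Nat.find_spec hex, he, fun t ht => ⟨fun h => ?_, fun h => ?_⟩⟩
    · exact ⟨Nat.find_min' hex h, Nat.le_findGreatest ht h⟩
    · exact hbet _ _ t h.1 h.2 hle (Nat.find_spec hex) he
  have hs0 : 1 ≤ s := by
    by_contra hc
    obtain rfl : s = 0 := by omega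
    exact hvy.2 (hf.start ▸ hs)
  have hek' : e + 1 ≤ k := by
    by_contra hc
    obtain rfl : e = k := by omega
    exact hvz.2 (hf.finish ▸ he)
  obtain ⟨d, rfl⟩ := Nat.exists_eq_add_of_le hse
  have hxf : ∀ t ≤ k, Far G x (f t) := fun t ht => (hf.mem t ht).2
  rcases Nat.lt_or_ge 1 d with hd | hd
  · have := graphD_isIndContained hf hs0 hek' hxv hxf hiff
    exact Or.inl (Or.inr <| Or.inr <| Or.inr <| Or.inl ⟨d, hd, this⟩)
  obtain rfl | rfl : d = 1 ∨ d = 0 := by omega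
  · have := graphA_isIndContained hf hs0 hek' hxv hxf hiff hwx hwv
      (fun t ht => (hf.mem t ht).1)
    exact Or.inl (Or.inl this)
  by_cases hend : s = 1 ∨ s + 1 = k
  · exact Or.inr ⟨s, hend, fun t ht => by rw [hiff t ht]; omega⟩
  -- The single neighbour `f s` has two path vertices on either side; with `v` and `x` as the third
  -- leg, it is the centre of e).
  left
  have hfar : ∀ t ≤ k, t ≠ s → Far G v (f t) := fun t ht hts =>
    ⟨hne t ht, fun h => hts (by have := (hiff t ht).1 h; omega)⟩
  have := graphE_isIndContained (c := f s) (a₁ := v) (b₁ := x) (a₂ := f (s - 1))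
    (b₂ := f (s - 2)) (a₃ := f (s + 1)) (b₃ := f (s + 2)) hs.symm
    ((hf.adj _ _ (by omega) (by omega)).2 (by omega))
    ((hf.adj _ _ (by omega) (by omega)).2 (by omega)) hxv.symm
    ((hf.adj _ _ (by omega) (by omega)).2 (by omega))
    ((hf.adj _ _ (by omega) (by omega)).2 (by omega)) (hxf s (by omega)).symm
    (hf.far (by omega) (by omega) (by omega)) (hf.far (by omega) (by omega) (by omega))
    (hfar _ (by omega) (by omega)) (hfar _ (by omega) (by omega))
    (hf.far (by omega) (by omega) (by omega))
    (hfar _ (by omega) (by omega)) (hfar _ (by omega) (by omega))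
    (hxf _ (by omega)).symm (hf.far (by omega) (by omega) (by omega))
    (hxf _ (by omega)).symm (hf.far (by omega) (by omega) (by omega))
    (hxf _ (by omega)) (hxf _ (by omega)) (hf.far (by omega) (by omega) (by omega))
  simp [ContainsForbidden, this]

/-- An asteroidal triple in `G - N[w]`, with the lengths of its walks. -/
structure IsAsteroidalTriple (G : SimpleGraph V) (w x y z : V) (k l m : ℕ) : Prop where
  yz : Joined G (FarBoth G w x) k y z
  xz : Joined G (FarBoth G w y) l x z
  xy : Joined G (FarBoth G w z) m x y

/-- An asteroidal triple in `G - N[w]` whose three walks are induced paths. -/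
structure AsteroidalPaths (G : SimpleGraph V) (w : V) (f g h : ℕ → V) (x y z : V) (k l m : ℕ) :
    Prop where
  yz : IsInducedPath G (FarBoth G w x) f k y z
  xz : IsInducedPath G (FarBoth G w y) g l x z
  xy : IsInducedPath G (FarBoth G w z) h m x y

namespace AsteroidalPaths

variable {w x y z : V} {f g h : ℕ → V} {k l m : ℕ}

theorem swap_xy (H : AsteroidalPaths G w f g h x y z k l m) :
    AsteroidalPaths G w g f (fun i => h (m - i)) y x z l k m := ⟨H.xz, H.yz, H.xy.rev⟩

theorem swap_yz (H : AsteroidalPaths G w f g h x y z k l m) :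
    AsteroidalPaths G w (fun i => f (k - i)) h g x z y k m l := ⟨H.yz.rev, H.xy, H.xz⟩

theorem far_xy (H : AsteroidalPaths G w f g h x y z k l m) : Far G x y :=
  H.yz.start ▸ (H.yz.mem 0 (by omega)).2

theorem far_xz (H : AsteroidalPaths G w f g h x y z k l m) : Far G x z :=
  H.yz.finish ▸ (H.yz.mem k le_rfl).2

theorem far_w (H : AsteroidalPaths G w f g h x y z k l m) : Far G w x :=
  H.xz.start ▸ (H.xz.mem 0 (by omega)).1

theorem two_le (H : AsteroidalPaths G w f g h x y z k l m) : 2 ≤ l := by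
  by_contra hc
  obtain rfl | rfl : l = 0 ∨ l = 1 := by omega
  · exact H.far_xz.1 (H.xz.start.symm.trans H.xz.finish)
  · have := H.xz.adj_succ (i := 0) (by omega)
    rw [H.xz.start, H.xz.finish] at this
    exact H.far_xz.2 this

theorem adj_first (H : AsteroidalPaths G w f g h x y z k l m) : G.Adj x (g 1) := by
  have := H.two_le
  have := H.xz.adj_succ (i := 0) (by omega)
  rwa [H.xz.start] at this

theorem first_ne (H : AsteroidalPaths G w f g h x y z k l m) (t : ℕ) (ht : t ≤ k) :
    g 1 ≠ f t := fun he => (H.yz.mem t ht).2.2 (he ▸ H.adj_first)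

/-- The edge from `x` to `g 1` lies on the closed walk formed by the three paths, where `h 1` is the
only other neighbour of `x`. The triangle on that edge must therefore use `h 1`. -/
theorem adj_first_first (hU : IsChordal (G.induce (closedNeighborSet G w)ᶜ))
    (H : AsteroidalPaths G w f g h x y z k l m) (hne : g 1 ≠ h 1) : G.Adj (g 1) (h 1) := by
  have hl := H.two_le
  have hm := H.swap_yz.two_le
  have hxg : ∀ t, 2 ≤ t → t ≤ l → Far G x (g t) := fun t h2 ht => by
    have := H.xz.far (i := 0) (j := t) (by omega) ht (by omega)
    rwa [H.xz.start] at this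
  have hxh : ∀ t, 2 ≤ t → t ≤ m → Far G x (h t) := fun t h2 ht => by
    have := H.xy.far (i := 0) (j := t) (by omega) ht (by omega)
    rwa [H.xy.start] at this
  let S : V → Prop := fun t => FarBoth G w x t ∨ t = h 1
  have hw1 : ∀ t, S t → Far G w t := by
    rintro t (ht | rfl)
    exacts [ht.1, (H.xy.mem 1 (by omega)).1]
  have j1 : Joined G S (m - 1) (h 1) (h m) := H.xy.joined 1 m (by omega) le_rfl fun t h1 ht => by
    rcases Nat.lt_or_ge 1 t with h2 | h2
    · exact Or.inl ⟨(H.xy.mem t ht).1, hxh t h2 ht⟩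
    · right
      rw [show t = 1 by omega]
  have j2 : Joined G S k y z := H.yz.joined_self.mono fun _ => Or.inl
  have j3 : Joined G S (l - 2) (g 2) (g l) := H.xz.joined 2 l (by omega) le_rfl fun t h1 ht =>
    Or.inl ⟨(H.xz.mem t ht).1, hxg t h1 ht⟩
  rw [H.xy.finish] at j1
  rw [H.xz.finish] at j3
  obtain ⟨s, hs, h1, h2⟩ := exists_common_neighbor hU (S := S)
    (fun t ht => mem_compl_closedNeighborSet.2 (hw1 t ht))
    (mem_compl_closedNeighborSet.2 H.far_w)
    (mem_compl_closedNeighborSet.2 (H.xz.mem 1 (by omega)).1) H.adj_first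
    (by rintro (h | h); exacts [h.2.1 rfl, H.swap_yz.adj_first.ne h])
    (by rintro (h | h); exacts [h.2.2 H.adj_first, hne h])
    (j1.trans (j2.trans j3.symm)) H.swap_yz.adj_first (H.xz.adj_succ (by omega))
  rcases hs with hs | rfl
  exacts [absurd h1 hs.2.2, h2]

/-- Two paths of length two at a common vertex of an asteroidal triple yield family c). -/
theorem of_length_two (hU : IsChordal (G.induce (closedNeighborSet G w)ᶜ))
    (H : AsteroidalPaths G w f g h x y z k 2 2) : ContainsForbidden G := by
  have hgz : G.Adj (g 1) z := H.xz.finish ▸ H.xz.adj_succ (i := 1) (by omega)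
  have hhy : G.Adj (h 1) y := H.xy.finish ▸ H.xy.adj_succ (i := 1) (by omega)
  have hgy := (H.xz.mem 1 (by omega)).2
  have hhz := (H.xy.mem 1 (by omega)).2
  have hwg := (H.xz.mem 1 (by omega)).1
  have hwh := (H.xy.mem 1 (by omega)).1
  have hgh := H.adj_first_first hU (fun he => hgy.2 (he ▸ hhy.symm))
  obtain ⟨i, hi, hi'⟩ := H.yz.exists_adj_iff_le hU
    (fun t ht => mem_compl_closedNeighborSet.2 ht.1) (mem_compl_closedNeighborSet.2 hwh)
    (fun t ht he => (H.yz.mem t ht).2.2 (he ▸ H.swap_yz.adj_first))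
    (by rwa [H.yz.start]) (by rw [H.yz.finish]; exact hhz.symm.2)
  obtain ⟨j, hj, hj'⟩ := H.yz.rev.exists_adj_iff_le hU
    (fun t ht => mem_compl_closedNeighborSet.2 ht.1) (mem_compl_closedNeighborSet.2 hwg)
    (fun t ht he => H.first_ne _ (by omega) he)
    (by rwa [H.yz.rev.start]) (by rw [H.yz.rev.finish]; exact hgy.symm.2)
  have hr : ∀ t ≤ k, (G.Adj (g 1) (f t) ↔ k - j ≤ t) := fun t ht => by
    have := hj' (k - t) (by omega)
    rw [show k - (k - t) = t by omega] at this
    rw [this]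
    omega
  -- The neighbours of `h 1` on `f` end at `i`, and those of `g 1` begin at `k - j`. If these
  -- segments were disjoint, the edge from `h 1` to `g 1` would lie on a cycle without a triangle.
  have hij : k - j ≤ i := by
    by_contra hc
    obtain ⟨s, ⟨t, h1, h2, rfl⟩, h3, h4⟩ := exists_common_neighbor hU
      (S := fun v => ∃ t, i ≤ t ∧ t ≤ k - j ∧ f t = v)
      (by rintro _ ⟨t, -, ht, rfl⟩
          exact mem_compl_closedNeighborSet.2 (H.yz.mem t (by omega)).1)
      (mem_compl_closedNeighborSet.2 hwh) (mem_compl_closedNeighborSet.2 hwg) hgh.symm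
      (by rintro ⟨t, -, ht, he⟩
          exact (H.yz.mem t (by omega)).2.2 (he ▸ H.swap_yz.adj_first))
      (by rintro ⟨t, -, ht, he⟩
          exact H.first_ne t (by omega) he.symm)
      (H.yz.joined i (k - j) (by omega) (by omega) fun t h1 h2 => ⟨t, h1, h2, rfl⟩)
      ((hi' i (by omega)).2 le_rfl) ((hr _ (by omega)).2 le_rfl)
    have := (hi' t (by omega)).1 h3
    have := (hr t (by omega)).1 h4
    omega
  have := graphC_isIndContained H.yz (s := k - j) (k := i - (k - j) + 1) (by omega) (by omega)
    (by omega) H.swap_yz.adj_first H.adj_first hgh.symm (fun t ht => (H.yz.mem t ht).2)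
    (fun t ht => by rw [hi' t ht]; omega) hr H.far_w hwh hwg (fun t ht => (H.yz.mem t ht).1)
  exact Or.inr <| Or.inr <| Or.inl ⟨_, by omega, this⟩

/-- If `g 1` has no neighbour on `f`, it can replace `x` in the triple: the walk to `z` becomes
shorter and the walk to `y` no longer. The bound `3 ≤ l` keeps `g 1` far from `z`. -/
theorem first_of_not_shorter {N : ℕ} (hU : IsChordal (G.induce (closedNeighborSet G w)ᶜ))
    (H : AsteroidalPaths G w f g h x y z k l m) (hN : k + l + m ≤ N)
    (ih : ∀ x y z k l m, k + l + m < N → IsAsteroidalTriple G w x y z k l m →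
      ContainsForbidden G) (hl : 3 ≤ l) :
    ContainsForbidden G ∨ ∃ i, (i = 1 ∨ i + 1 = k) ∧ ∀ t ≤ k, (G.Adj (g 1) (f t) ↔ t = i) := by
  have hm := H.swap_yz.two_le
  have hg1 := H.xz.mem 1 (by omega)
  have hgz : Far G (g 1) z := H.xz.finish ▸ H.xz.far (by omega) le_rfl (by omega)
  by_cases hex : ∃ i ≤ k, G.Adj (g 1) (f i)
  · exact containsForbidden_or_unique_neighbor hU H.yz H.adj_first hg1.2.symm hgz hg1.1 H.far_w hex
  push Not at hex
  left
  have hyz : Joined G (FarBoth G w (g 1)) k y z := by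
    have := H.yz.joined (Q := FarBoth G w (g 1)) 0 k (by omega) le_rfl
      fun t _ ht => ⟨(H.yz.mem t ht).1, H.first_ne t ht, hex t ht⟩
    rwa [H.yz.start, H.yz.finish] at this
  by_cases he : g 1 = h 1
  · exact ih (g 1) y z k (l - 1) (m - 1) (by omega)
      ⟨hyz, H.xz.joined_from 1 (by omega), he ▸ H.xy.joined_from 1 (by omega)⟩
  · exact ih (g 1) y z k (l - 1) (m - 1 + 1) (by omega)
      ⟨hyz, H.xz.joined_from 1 (by omega), .cons (H.adj_first_first hU he) ⟨hg1.1, hgz.symm⟩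
        (H.xy.joined_from 1 (by omega))⟩

/-- Both paths end at `z`, so the edge from `g 1` to `f 1` lies on a closed walk through their
tails. Uniqueness of the neighbours leaves no vertex of the tails for a triangle. -/
theorem not_unique_neighbors (hU : IsChordal (G.induce (closedNeighborSet G w)ᶜ))
    (H : AsteroidalPaths G w f g h x y z k l m) (hk : 3 ≤ k) (hl : 3 ≤ l)
    (hgf : ∀ t ≤ k, (G.Adj (g 1) (f t) ↔ t = 1)) (hfg : ∀ t ≤ l, (G.Adj (f 1) (g t) ↔ t = 1)) :
    False := by
  have j1 : Joined G (fun v => (∃ t, 2 ≤ t ∧ t ≤ k ∧ f t = v) ∨ ∃ t, 2 ≤ t ∧ t ≤ l ∧ g t = v)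
      (l - 2) (g 2) (g l) :=
    H.xz.joined 2 l (by omega) le_rfl fun t h1 h2 => Or.inr ⟨t, h1, h2, rfl⟩
  have j2 : Joined G (fun v => (∃ t, 2 ≤ t ∧ t ≤ k ∧ f t = v) ∨ ∃ t, 2 ≤ t ∧ t ≤ l ∧ g t = v)
      (k - 2) (f 2) (f k) :=
    H.yz.joined 2 k (by omega) le_rfl fun t h1 h2 => Or.inl ⟨t, h1, h2, rfl⟩
  rw [H.xz.finish] at j1
  rw [H.yz.finish] at j2
  obtain ⟨s, hs, h1, h2⟩ := exists_common_neighbor hU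
    (by rintro _ (⟨t, -, ht, rfl⟩ | ⟨t, -, ht, rfl⟩)
        exacts [mem_compl_closedNeighborSet.2 (H.yz.mem t ht).1,
          mem_compl_closedNeighborSet.2 (H.xz.mem t ht).1])
    (mem_compl_closedNeighborSet.2 (H.xz.mem 1 (by omega)).1)
    (mem_compl_closedNeighborSet.2 (H.yz.mem 1 (by omega)).1) ((hgf 1 (by omega)).2 rfl)
    (by rintro (⟨t, ht2, ht, he⟩ | ⟨t, ht2, ht, he⟩)
        · exact H.first_ne t ht he.symm
        · have := H.xz.inj _ _ ht (by omega) he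
          omega)
    (by rintro (⟨t, ht2, ht, he⟩ | ⟨t, ht2, ht, he⟩)
        · have := H.yz.inj _ _ ht (by omega) he
          omega
        -- If `f 1` lay on the tail of `g`, it would be `g 2`, hence also adjacent to `g 3`, which
        -- exists since `3 ≤ l`.
        · have h1 := (hgf 1 (by omega)).2 rfl
          rw [← he, H.xz.adj _ _ (by omega) ht] at h1
          obtain rfl : t = 2 := by omega
          have h3 := H.xz.adj_succ (i := 2) (by omega)
          rw [he] at h3
          have := (hfg _ (by omega)).1 h3
          omega)
    (j1.trans j2.symm) (H.xz.adj_succ (by omega)) (H.yz.adj_succ (by omega))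
  obtain ⟨t, ht2, ht, rfl⟩ | ⟨t, ht2, ht, rfl⟩ := hs
  · have := (hgf t ht).1 h1
    omega
  · have := (hfg t ht).1 h2
    omega

/-- The neighbour of `h 1` on `f` lies next to `y` or next to `z`. In the latter case, the same
analysis from `z` makes `h 1` the only neighbour of `f (k - 1)` on `h`, which `not_unique_neighbors`
excludes. -/
theorem unique_neighbor {N : ℕ} (hU : IsChordal (G.induce (closedNeighborSet G w)ᶜ))
    (H : AsteroidalPaths G w f g h x y z k l m) (hN : k + l + m ≤ N)
    (ih : ∀ x y z k l m, k + l + m < N → IsAsteroidalTriple G w x y z k l m →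
      ContainsForbidden G) (hk : 3 ≤ k) (hm : 3 ≤ m) :
    ContainsForbidden G ∨ ∀ t ≤ k, (G.Adj (h 1) (f t) ↔ t = 1) := by
  obtain hF | ⟨i, hi, hi'⟩ := H.swap_yz.first_of_not_shorter hU (by omega) ih hm
  · exact Or.inl hF
  by_cases hi1 : i = 1
  · subst hi1
    obtain hF | ⟨j, hj, hj'⟩ := H.swap_yz.swap_xy.first_of_not_shorter hU (by omega) ih hk
    · exact Or.inl hF
    have h1 := (hj' 1 (by omega)).1 ((hi' 1 (by omega)).2 rfl).symm
    subst h1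
    exact (H.swap_yz.not_unique_neighbors hU hk hm hi' hj').elim
  · right
    intro t ht
    have := hi' (k - t) (by omega)
    rw [show k - (k - t) = t by omega] at this
    rw [this]
    omega

/-- In the absence of a forbidden subgraph, `h 1` sees only `f 1` and `g 1` sees only `f (k - 1)`.
With the edge from `h 1` to `g 1` these bound a cycle in which that edge lies in no triangle. -/
theorem of_three_le {N : ℕ} (hU : IsChordal (G.induce (closedNeighborSet G w)ᶜ))
    (H : AsteroidalPaths G w f g h x y z k l m) (hN : k + l + m ≤ N)
    (ih : ∀ x y z k l m, k + l + m < N → IsAsteroidalTriple G w x y z k l m →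
      ContainsForbidden G) (hk : 3 ≤ k) (hl : 3 ≤ l) (hm : 3 ≤ m) : ContainsForbidden G := by
  obtain hF | hh := H.unique_neighbor hU hN ih hk hm
  · exact hF
  obtain hF | hg := H.swap_yz.unique_neighbor hU (by omega) ih hk hl
  · exact hF
  have hg' : ∀ t ≤ k, (G.Adj (g 1) (f t) ↔ t = k - 1) := fun t ht => by
    have := hg (k - t) (by omega)
    rw [show k - (k - t) = t by omega] at this
    rw [this]
    omega
  have hne : g 1 ≠ h 1 := fun he => by
    have h1 := (hh 1 (by omega)).2 rfl
    rw [← he, hg' 1 (by omega)] at h1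
    omega
  obtain ⟨s, ⟨t, h1, h2, rfl⟩, h3, h4⟩ := exists_common_neighbor hU
    (S := fun v => ∃ t, 1 ≤ t ∧ t ≤ k - 1 ∧ f t = v)
    (by rintro _ ⟨t, -, ht, rfl⟩
        exact mem_compl_closedNeighborSet.2 (H.yz.mem t (by omega)).1)
    (mem_compl_closedNeighborSet.2 (H.xy.mem 1 (by omega)).1)
    (mem_compl_closedNeighborSet.2 (H.xz.mem 1 (by omega)).1)
    (H.adj_first_first hU hne).symm
    (by rintro ⟨t, -, ht, he⟩
        exact (H.yz.mem t (by omega)).2.2 (he ▸ H.swap_yz.adj_first))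
    (by rintro ⟨t, -, ht, he⟩
        exact H.first_ne t (by omega) he.symm)
    (H.yz.joined 1 (k - 1) (by omega) (by omega) fun t h1 h2 => ⟨t, h1, h2, rfl⟩)
    ((hh 1 (by omega)).2 rfl) ((hg' _ (by omega)).2 rfl)
  have := (hh t (by omega)).1 h3
  have := (hg' t (by omega)).1 h4
  omega

/-- The middle vertex `g 1` of the short path becomes the hub of b): it sees `f 1` and `z`, hence
everything on `f` between them. -/
theorem of_one_length_two {N : ℕ} (hU : IsChordal (G.induce (closedNeighborSet G w)ᶜ))
    (H : AsteroidalPaths G w f g h x y z k 2 m) (hN : k + 2 + m ≤ N)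
    (ih : ∀ x y z k l m, k + l + m < N → IsAsteroidalTriple G w x y z k l m →
      ContainsForbidden G) (hk : 3 ≤ k) (hm : 3 ≤ m) : ContainsForbidden G := by
  obtain hF | hh := H.unique_neighbor hU hN ih hk hm
  · exact hF
  have U {t} (ht : Far G w t) := mem_compl_closedNeighborSet.2 ht
  have hgz : G.Adj (g 1) z := H.xz.finish ▸ H.xz.adj_succ (i := 1) (by omega)
  have hgy := (H.xz.mem 1 (by omega)).2
  have hhz := (H.xy.mem 1 (by omega)).2
  have hwg := (H.xz.mem 1 (by omega)).1
  have hwh := (H.xy.mem 1 (by omega)).1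
  have hf := H.yz.mem
  have hhf : G.Adj (h 1) (f 1) := (hh 1 (by omega)).2 rfl
  have hgh := H.adj_first_first hU (fun he => hhz.2 (he ▸ hgz.symm))
  have hhne : ∀ t ≤ k, h 1 ≠ f t := fun t ht he => (hf t ht).2.2 (he ▸ H.swap_yz.adj_first)
  -- The edge from `h 1` to `f 1` lies on the cycle that continues along `f` to `z` and returns
  -- through `g 1`. Since `h 1` has no other neighbour on `f`, the triangle must use `g 1`.
  have hgf : G.Adj (g 1) (f 1) := by
    have j : Joined G (fun v => (∃ t, 2 ≤ t ∧ t ≤ k ∧ f t = v) ∨ v = g 1) (k - 2) (f 2) (f k) :=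
      H.yz.joined 2 k (by omega) le_rfl fun t h1 h2 => Or.inl ⟨t, h1, h2, rfl⟩
    rw [H.yz.finish] at j
    obtain ⟨s, hs, h1, h2⟩ := exists_common_neighbor hU
      (by rintro _ (⟨t, -, ht, rfl⟩ | rfl)
          exacts [U (hf t ht).1, U hwg]) (U hwh) (U (hf 1 (by omega)).1) hhf
      (by rintro (⟨t, -, ht, he⟩ | he)
          exacts [hhne t ht he.symm, hgh.ne he.symm])
      (by rintro (⟨t, ht2, ht, he⟩ | he)
          · have := H.yz.inj _ _ ht (by omega) he
            omega
          · exact H.first_ne 1 (by omega) he.symm)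
      (.cons hgz (Or.inr rfl) j.symm) hgh.symm (H.yz.adj_succ (by omega))
    obtain ⟨t, ht2, ht, rfl⟩ | rfl := hs
    · have := (hh t ht).1 h1
      omega
    · exact h2.symm
  have hbet := fun t h1 (ht : t ≤ k) => H.yz.adj_of_between hU (fun t ht => U ht.1) (U hwg)
    H.first_ne (i := 1) (j := k) (k := t) h1 ht le_rfl hgf (by rwa [H.yz.finish])
  have hhfar : ∀ t ≤ k, t ≠ 1 → Far G (h 1) (f t) := fun t ht h1 =>
    ⟨hhne t ht, fun h => h1 ((hh t ht).1 h)⟩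
  have hfy := fun t => H.yz.far (i := t) (j := 0)
  have hy1 : G.Adj (f 1) y := H.yz.start ▸ (H.yz.adj_succ (i := 0) (by omega)).symm
  have hhy : Far G (h 1) y := H.yz.start ▸ hhfar 0 (by omega) (by omega)
  simp only [H.yz.start] at hfy
  have := graphB_isIndContained (p₀ := x) (p₁ := h 1) (p₂ := f 1) (p₃ := f 2) (p₄ := f 3)
    (h := g 1) (x := y) (w := w) H.swap_yz.adj_first hhf (H.yz.adj_succ (by omega))
    (H.yz.adj_succ (by omega)) H.adj_first hgh.symm hgf.symm
    (hbet 2 (by omega) (by omega)).symm (hbet 3 (by omega) (by omega)).symm hy1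
    (hf 1 (by omega)).2 (hf 2 (by omega)).2 (hf 3 (by omega)).2
    (hhfar 2 (by omega) (by omega)) (hhfar 3 (by omega) (by omega))
    (H.yz.far (by omega) (by omega) (by omega)) H.far_xy hhy
    (hfy 2 (by omega) (by omega) (by omega)) (hfy 3 (by omega) (by omega) (by omega))
    hgy.symm H.far_w.symm hwh.symm (hf 1 (by omega)).1.symm (hf 2 (by omega)).1.symm
    (hf 3 (by omega)).1.symm hwg.symm H.swap_xy.far_w.symm
  exact Or.inr (Or.inl this)

end AsteroidalPaths

/-- Only `w` stays fixed in the induction; the vertices of the triple may change. Once the walks are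
induced, the cases depend on which of them have length two. -/
theorem IsAsteroidalTriple.containsForbidden {w : V}
    (hU : IsChordal (G.induce (closedNeighborSet G w)ᶜ)) {x y z : V} {k l m : ℕ}
    (H : IsAsteroidalTriple G w x y z k l m) : ContainsForbidden G := by
  generalize hN : k + l + m = N
  induction N using Nat.strong_induction_on generalizing x y z k l m with
  | _ N ih =>
    have ih : ∀ x y z k l m, k + l + m < N → IsAsteroidalTriple G w x y z k l m →
      ContainsForbidden G := fun x y z k l m hlt H => ih _ hlt H rfl
    rcases H.yz.shorter_or_isInducedPath with ⟨k', hk', h'⟩ | ⟨f, hf⟩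
    · exact ih x y z k' l m (by omega) ⟨h', H.xz, H.xy⟩
    rcases H.xz.shorter_or_isInducedPath with ⟨l', hl', h'⟩ | ⟨g, hg⟩
    · exact ih x y z k l' m (by omega) ⟨H.yz, h', H.xy⟩
    rcases H.xy.shorter_or_isInducedPath with ⟨m', hm', h'⟩ | ⟨h, hh⟩
    · exact ih x y z k l m' (by omega) ⟨H.yz, H.xz, h'⟩
    have A : AsteroidalPaths G w f g h x y z k l m := ⟨hf, hg, hh⟩
    rcases Nat.lt_or_eq_of_le A.swap_xy.two_le with hk | rfl <;>
      rcases Nat.lt_or_eq_of_le A.two_le with hl | rfl <;>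
      rcases Nat.lt_or_eq_of_le A.swap_yz.two_le with hm | rfl
    · exact A.of_three_le hU (by omega) ih hk hl hm
    · exact A.swap_yz.of_one_length_two hU (by omega) ih hk hl
    · exact A.of_one_length_two hU (by omega) ih hk hm
    · exact A.of_length_two hU
    · exact A.swap_xy.of_one_length_two hU (by omega) ih hl hm
    · exact A.swap_xy.of_length_two hU
    · exact A.swap_yz.swap_xy.of_length_two hU
    · exact A.of_length_two hU

/-! ### Translating between avoidance and walks of far vertices -/

theorem exists_adj_mem_support {u v z : V} (p : G.Walk u v) (huv : u ≠ v) (hz : z ∈ p.support) :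
    ∃ t ∈ p.support, G.Adj z t := by
  obtain ⟨i, rfl, hi⟩ := SimpleGraph.Walk.mem_support_iff_exists_getVert.1 hz
  have h0 : p.length ≠ 0 := fun h => huv (SimpleGraph.Walk.eq_of_length_eq_zero h)
  rcases Nat.lt_or_ge i p.length with h | h
  · exact ⟨_, p.getVert_mem_support (i + 1), p.adj_getVert_succ h⟩
  · have := p.adj_getVert_succ (i := i - 1) (by omega)
    rw [show i - 1 + 1 = i by omega] at this
    exact ⟨_, p.getVert_mem_support (i - 1), this.symm⟩

/-- Missing a walk forbids only neighbours on it, but each vertex of a walk with distinct ends has a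
neighbour on that walk, so a missing vertex cannot lie on it. -/
theorem Joined.of_misses {x y z w : V} (hxy : x ≠ y) (p : G.Walk x y) (hz : Misses G z p)
    (hw : Misses G w p) : Joined G (FarBoth G z w) p.length x y := by
  refine ⟨p, rfl, fun t ht => ⟨⟨?_, hz t ht⟩, ⟨?_, hw t ht⟩⟩⟩ <;> rintro rfl <;>
    obtain ⟨s, hs, h⟩ := exists_adj_mem_support p hxy ht
  exacts [hz s hs h, hw s hs h]

theorem Avoid.joined {x y z w : V} (h : Avoid G x y z w) (hxy : x ≠ y) (hzw : z ≠ w) :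
    (∃ n, Joined G (FarBoth G z w) n x y) ∨ ∃ n, Joined G (FarBoth G x y) n z w := by
  rcases h with ⟨p, -, h1, h2⟩ | ⟨p, -, h1, h2⟩
  exacts [Or.inl ⟨_, .of_misses hxy p h1 h2⟩, Or.inr ⟨_, .of_misses hzw p h1 h2⟩]

theorem Joined.avoid {x y z w : V} {n : ℕ}
    (h : Joined G (fun t => ¬ G.Adj z t ∧ ¬ G.Adj w t) n x y) : Avoid G x y z w := by
  classical
  obtain ⟨p, -, h⟩ := h
  exact Or.inl ⟨p.bypass, p.bypass_isPath,
    fun t ht => (h t (p.support_bypass_subset_support ht)).1,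
    fun t ht => (h t (p.support_bypass_subset_support ht)).2⟩

theorem Avoid.comm {x y z w : V} (h : Avoid G x y z w) : Avoid G z w x y := Or.symm h

theorem Avoid.map {W : Type*} {H : SimpleGraph W} (φ : H ↪g G) {x y z w : W}
    (h : Avoid H x y z w) : Avoid G (φ x) (φ y) (φ z) (φ w) := by
  have key : ∀ {x y z : W} (p : H.Walk x y), Misses H z p → Misses G (φ z) (p.map φ.toHom) := by
    intro x y z p h t ht
    rw [SimpleGraph.Walk.support_map, List.mem_map] at ht
    obtain ⟨s, hs, rfl⟩ := ht
    intro ha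
    exact h s hs (φ.map_rel_iff.1 ha)
  rcases h with ⟨p, hp, h1, h2⟩ | ⟨p, hp, h1, h2⟩
  · exact Or.inl ⟨p.map φ.toHom, hp.map φ.injective, key p h1, key p h2⟩
  · exact Or.inr ⟨p.map φ.toHom, hp.map φ.injective, key p h1, key p h2⟩

theorem HasBlockingQuadruple.of_isIndContained {W : Type*} {H : SimpleGraph W}
    (hH : HasBlockingQuadruple H) (h : H.IsIndContained G) : HasBlockingQuadruple G := by
  obtain ⟨φ⟩ := h
  obtain ⟨x, y, z, w, ⟨h1, h2, h3, h4, h5, h6⟩, a1, a2, a3⟩ := hH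
  exact ⟨φ x, φ y, φ z, φ w, ⟨φ.injective.ne h1, φ.injective.ne h2, φ.injective.ne h3,
    φ.injective.ne h4, φ.injective.ne h5, φ.injective.ne h6⟩, a1.map φ, a2.map φ, a3.map φ⟩

theorem Joined.two {P : V → Prop} {a b c : V} (h₁ : G.Adj a b) (h₂ : G.Adj b c) (ha : P a)
    (hb : P b) (hc : P c) : Joined G P 2 a c := .cons h₁ ha (.cons h₂ hb (.refl hc))

theorem Joined.three {P : V → Prop} {a b c d : V} (h₁ : G.Adj a b) (h₂ : G.Adj b c)
    (h₃ : G.Adj c d) (ha : P a) (hb : P b) (hc : P c) (hd : P d) : Joined G P 3 a d :=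
  .cons h₁ ha (.two h₂ h₃ hb hc hd)

/-! ### Blocking quadruples in the listed graphs -/

theorem hasBlockingQuadruple_graphA : HasBlockingQuadruple graphA := by
  refine ⟨3, 4, 5, 6, by decide, (Joined.three (b := 0) (c := 1) ?_ ?_ ?_ ?_ ?_ ?_ ?_).avoid,
    (Joined.three (b := 0) (c := 2) ?_ ?_ ?_ ?_ ?_ ?_ ?_).avoid,
    (Joined.three (b := 1) (c := 2) ?_ ?_ ?_ ?_ ?_ ?_ ?_).avoid.comm⟩ <;> simp [graphA]

theorem hasBlockingQuadruple_graphB : HasBlockingQuadruple graphB := by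
  refine ⟨0, 4, 6, 7, by decide, (Joined.two (b := 5) ?_ ?_ ?_ ?_ ?_).avoid,
    (Joined.three (b := 1) (c := 2) ?_ ?_ ?_ ?_ ?_ ?_ ?_).avoid,
    (Joined.three (b := 3) (c := 2) ?_ ?_ ?_ ?_ ?_ ?_ ?_).avoid.comm⟩ <;> simp [graphB]

theorem hasBlockingQuadruple_graphC {k : ℕ} (hk : 1 ≤ k) : HasBlockingQuadruple (graphC k) := by
  -- The minimum only makes the enumeration of the path total; indices beyond `k - 1` are never
  -- reached.
  let f : ℕ → VertexC k := fun i => .p ⟨min i (k - 1), by omega⟩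
  have hf := Joined.of_chain (G := graphC k) (P := fun t => ¬ (graphC k).Adj .a t ∧
    ¬ (graphC k).Adj .d t) f 0 (k - 1) (by omega)
    (fun t _ ht => by simp [f, graphC, edgeC]; omega) (fun t _ ht => by simp [f, graphC, edgeC])
  have hbc := Joined.cons (u := .b) (by simp [f, graphC, edgeC]) (by simp [graphC, edgeC])
    (Joined.cons (u := .c) (by simp [f, graphC, edgeC]; omega) (by simp [graphC, edgeC])
      hf.symm).symm
  exact ⟨.a, .b, .c, .d, by simp, (Joined.two (b := .l) (by simp [graphC, edgeC])
    (by simp [graphC, edgeC]) (by simp [graphC, edgeC]) (by simp [graphC, edgeC])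
    (by simp [graphC, edgeC])).avoid, (Joined.two (b := .r) (by simp [graphC, edgeC])
    (by simp [graphC, edgeC]) (by simp [graphC, edgeC]) (by simp [graphC, edgeC])
    (by simp [graphC, edgeC])).avoid, hbc.avoid.comm⟩

theorem hasBlockingQuadruple_graphD {m : ℕ} (hm : 2 ≤ m) : HasBlockingQuadruple (graphD m) := by
  let f : ℕ → VertexD m := fun i => .p ⟨min i m, by omega⟩
  -- The quadruple is a star centred at `p 1`. The walk towards `c` starts there because `p 0` is
  -- adjacent to `b`; `m ≥ 2` makes `p 1` an inner vertex of the path.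
  have hc := Joined.of_chain (G := graphD m) (P := fun t => ¬ (graphD m).Adj .a t ∧
    ¬ (graphD m).Adj .b t) f 1 m (by omega)
    (fun t _ ht => by simp [f, graphD, edgeD]; omega)
    (fun t ht _ => by simp [f, graphD, edgeD]; omega)
  have hb : Joined (graphD m) (fun t => ¬ (graphD m).Adj .a t ∧ ¬ (graphD m).Adj .c t) 2 .b (f 1) :=
    .two (b := f 0) (by simp [f, graphD, edgeD]) (by simp [f, graphD, edgeD]; omega)
      (by simp [graphD, edgeD]) (by simp [f, graphD, edgeD]; omega)
      (by simp [f, graphD, edgeD]; omega)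
  have ha : Joined (graphD m) (fun t => ¬ (graphD m).Adj .b t ∧ ¬ (graphD m).Adj .c t) 2 .a (f 1) :=
    .two (b := .h) (by simp [graphD, edgeD]) (by simp [f, graphD, edgeD])
      (by simp [graphD, edgeD]) (by simp [graphD, edgeD])
      (by simp [f, graphD, edgeD]; omega)
  have hc' := Joined.cons (u := .c) (by simp [f, graphD, edgeD]) (by simp [graphD, edgeD]) hc.symm
  exact ⟨f 1, .a, .b, .c, by simp [f], ha.symm.avoid,
    hb.symm.avoid, hc'.symm.avoid⟩

theorem hasBlockingQuadruple_graphE : HasBlockingQuadruple graphE := by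
  refine ⟨0, 4, 5, 6, by decide, (Joined.two (b := 1) ?_ ?_ ?_ ?_ ?_).avoid,
    (Joined.two (b := 2) ?_ ?_ ?_ ?_ ?_).avoid,
    (Joined.two (b := 3) ?_ ?_ ?_ ?_ ?_).avoid⟩ <;> simp [graphE]

theorem hasBlockingQuadruple_graphF : HasBlockingQuadruple graphF := by
  refine ⟨2, 3, 4, 6, by decide, (Joined.two (b := 0) ?_ ?_ ?_ ?_ ?_).avoid,
    (Joined.two (b := 1) ?_ ?_ ?_ ?_ ?_).avoid,
    (Joined.two (b := 5) ?_ ?_ ?_ ?_ ?_).avoid⟩ <;> simp [graphF]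

theorem hasBlockingQuadruple_graphG : HasBlockingQuadruple graphG := by
  refine ⟨3, 4, 5, 6, by decide, (Joined.two (b := 0) ?_ ?_ ?_ ?_ ?_).avoid,
    (Joined.two (b := 1) ?_ ?_ ?_ ?_ ?_).avoid,
    (Joined.two (b := 2) ?_ ?_ ?_ ?_ ?_).avoid⟩ <;> simp [graphG]

/-- Each of the graphs a)-g) has a blocking quadruple, and so does every graph that contains one
of them as an induced subgraph. -/
theorem ContainsForbidden.hasBlockingQuadruple (h : ContainsForbidden G) :
    HasBlockingQuadruple G := by
  rcases h with h | h | ⟨k, hk, h⟩ | ⟨m, hm, h⟩ | h | h | h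
  exacts [hasBlockingQuadruple_graphA.of_isIndContained h,
    hasBlockingQuadruple_graphB.of_isIndContained h,
    (hasBlockingQuadruple_graphC hk).of_isIndContained h,
    (hasBlockingQuadruple_graphD hm).of_isIndContained h,
    hasBlockingQuadruple_graphE.of_isIndContained h,
    hasBlockingQuadruple_graphF.of_isIndContained h,
    hasBlockingQuadruple_graphG.of_isIndContained h]

/-! ### The equivalence -/

/-- Of the eight ways to choose one walk per avoidance, four share an endpoint and give stars, and
four form a triangle on three of the vertices. -/
theorem HasBlockingQuadruple.containsForbidden (hG : IsNearlyChordal G)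
    (h : HasBlockingQuadruple G) : ContainsForbidden G := by
  obtain ⟨x, y, z, w, ⟨xy, xz, xw, yz, yw, zw⟩, h1, h2, h3⟩ := h
  have C : ∀ {a b c d : V} {n : ℕ}, Joined G (FarBoth G a b) n c d →
      Joined G (FarBoth G b a) n c d :=
    fun h => h.mono fun _ => And.symm
  rcases h1.joined xy zw with ⟨a, h1⟩ | ⟨a, h1⟩ <;> rcases h2.joined xz yw with ⟨b, h2⟩ | ⟨b, h2⟩ <;>
    rcases h3.joined xw yz with ⟨c, h3⟩ | ⟨c, h3⟩
  · exact IsStar.containsForbidden hG (w := x) (x := y) (y := z) (z := w) ⟨h1, h2, h3⟩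
  · exact IsAsteroidalTriple.containsForbidden (hG w) (x := x) (y := y) (z := z)
      ⟨C h3, C h2, C h1⟩
  · exact IsAsteroidalTriple.containsForbidden (hG z) (x := x) (y := y) (z := w)
      ⟨C h2, C h3, h1⟩
  · exact IsStar.containsForbidden hG (w := y) (x := x) (y := z) (z := w)
      ⟨h1.symm, h3, h2⟩
  · exact IsAsteroidalTriple.containsForbidden (hG y) (x := x) (y := z) (z := w)
      ⟨C h1, h3, h2⟩
  · exact IsStar.containsForbidden hG (w := z) (x := x) (y := y) (z := w)
      ⟨h2.symm, h3.symm, h1⟩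
  · exact IsStar.containsForbidden hG (w := w) (x := x) (y := y) (z := z)
      ⟨h3.symm, h2.symm, h1.symm⟩
  · exact IsAsteroidalTriple.containsForbidden (hG x) (x := y) (y := z) (z := w)
      ⟨h1, h2, h3⟩

/-- A chord joins two vertices of the cycle, so it already belongs to any induced subgraph
containing the cycle. -/
theorem IsChordal.isNearlyChordal (hG : IsChordal G) : IsNearlyChordal G := by
  intro v u c hc hlen
  let φ : G.induce (closedNeighborSet G v)ᶜ ↪g G := SimpleGraph.Embedding.induce _
  obtain ⟨x, hx, y, hy, hxy, he⟩ := hG _ (c.map φ.toHom) (hc.map φ.injective) (by simpa using hlen)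
  rw [SimpleGraph.Walk.support_map, List.mem_map] at hx hy
  obtain ⟨x, hx, rfl⟩ := hx
  obtain ⟨y, hy, rfl⟩ := hy
  refine ⟨x, hx, y, hy, φ.map_rel_iff.1 hxy, fun h => he ?_⟩
  rw [SimpleGraph.Walk.edges_map, List.mem_map]
  exact ⟨_, h, rfl⟩

end BlockingQuadruple

theorem theorem3 {V : Type*} (G : SimpleGraph V) :
    (BlockingQuadruple.IsNearlyChordal G →
      (BlockingQuadruple.HasBlockingQuadruple G ↔ BlockingQuadruple.ContainsForbidden G)) ∧
    (BlockingQuadruple.IsChordal G →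
      (BlockingQuadruple.HasBlockingQuadruple G ↔ BlockingQuadruple.ContainsForbidden G)) :=
  ⟨fun hG => ⟨fun h => h.containsForbidden hG, fun h => h.hasBlockingQuadruple⟩,
    fun hG => ⟨fun h => h.containsForbidden hG.isNearlyChordal, fun h => h.hasBlockingQuadruple⟩⟩
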